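/- **Model.** Let $V=\{1,\dots,n\}$, $p\in(0,1]$ and $S\subseteq V$ with $|S|=k$ ($S$ is chosen by an adversary). Every pair $\{u,v\}$ with $u\in S$, $v\in V\setminus S$ is put into a random set $E'$ independently with probability $p$; no other pair is in $E'$. Seeing $E'$, the adversary then picks an arbitrary graph $G=(V,E)$ with $E\supseteq E'$ in which $S$ is an independent set. **Algorithm** (deterministic; its input is $G$ only, not $S$, $k$ or $p$). Solve the semidefinite program (C-SDP) $$\text{minimize } \sum_{u,v\in V}\|x_u-x_v\|^2\quad\text{subject to}\quad \|x_u\|^2=1\ (u\in V),\quad \langle x_u,x_v\rangle\ge 0\ (u,v\in V),\quad \langle x_u,x_v\rangle=0\ (\{u,v\}\in E)$$ over vectors $x_u\in\mathbb R^n$. For every vertex $u$ form the candidate set $\{v:\|x_u-x_v\|<1\}$ and extend it greedily: go through the vertices in order and add each one that is not adjacent to any vertex already in the set. Return a largest one among the candidate sets that are independent in $G$ (the empty set if there is none). **Statement.** (i) The C-SDP of every graph has an optimal solution. (ii) Given the solution of the C-SDP, the rest of the algorithm takes a number of elementary steps (adjacency queries, arithmetic operations on and comparisons of coordinates, list operations)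 bounded by a polynomial in $n$. (iii) There is an absolute constant $c>0$ such that, whenever $$k\ \ge\ c\,\Big(\frac np\Big)^{2/3},$$ with high probability over $E'$ the following holds: for every choice of $G$ by the adversary and every optimal solution of the C-SDP of $G$, the algorithm returns an independent set of $G$ with at least $k$ vertices. Here "with high probability" means with probability tending to $1$ as $n\to\infty$, uniformly in $p$, $k$ and $S$: for every $\varepsilon>0$ there is $N$ such that for all $n\ge N$, all $p\in(0,1]$, all $k$ with $k\ge c(n/p)^{2/3}$ and all $S$ with $|S|=k$ the probability is at least $1-\varepsilon$. -/

import Mathlib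

noncomputable section

namespace SemiRandom

open MeasureTheory ProbabilityTheory

/-! ### The semi-random model -/

/-- The boundary of `S`: all unordered pairs with one endpoint in `S` and the other outside `S`. -/
def boundary {n : ℕ} (S : Finset (Fin n)) : Set (Sym2 (Fin n)) :=
  {e | ∃ u ∈ S, ∃ v ∉ S, e = s(u, v)}

/-- Law of the random edge set `E'`: every boundary pair of `S` belongs to `E'` independently with
probability `p`, and no other pair belongs to `E'`. -/
def boundaryLaw {n : ℕ} (S : Finset (Fin n)) (p : unitInterval) : Measure (Set (Sym2 (Fin n))) :=
  setBernoulli (boundary S) p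

/-- The graphs which the adversary may present once `E'` has been drawn: all the edges of `E'` are
present, `S` is independent, and everything else is arbitrary. -/
def Admissible {n : ℕ} (S : Finset (Fin n)) (E' : Set (Sym2 (Fin n)))
    (G : SimpleGraph (Fin n)) : Prop :=
  SimpleGraph.fromEdgeSet E' ≤ G ∧ G.IsIndepSet (S : Set (Fin n))

/-! ### The crude semidefinite program

One vector per vertex. As `n` vectors span a space of dimension at most `n`, it is no restriction
to take the vectors in `ℝⁿ`. -/

/-- Feasibility for the crude SDP of `G`. -/
structure IsFeasible {n : ℕ} (G : SimpleGraph (Fin n))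
    (x : Fin n → EuclideanSpace ℝ (Fin n)) : Prop where
  norm_sq_eq_one : ∀ u, ‖x u‖ ^ 2 = 1
  inner_nonneg : ∀ u v, 0 ≤ inner ℝ (x u) (x v)
  inner_eq_zero : ∀ u v, G.Adj u v → inner ℝ (x u) (x v) = 0

/-- The objective of the crude SDP, to be minimized. -/
def objective {n : ℕ} (x : Fin n → EuclideanSpace ℝ (Fin n)) : ℝ :=
  ∑ u, ∑ v, ‖x u - x v‖ ^ 2

/-- `x` is an optimal solution of the crude SDP of `G`. -/
def IsOptimal {n : ℕ} (G : SimpleGraph (Fin n))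
    (x : Fin n → EuclideanSpace ℝ (Fin n)) : Prop :=
  IsFeasible G x ∧ ∀ y, IsFeasible G y → objective x ≤ objective y

/-! ### Step counting -/

/-- A computation together with the number of elementary steps it takes. -/
structure Timed (α : Type) where
  val : α
  steps : ℕ

namespace Timed

/-- Sequential composition adds up the steps. -/
instance : Monad Timed where
  pure a := ⟨a, 0⟩
  bind m f := ⟨(f m.val).val, m.steps + (f m.val).steps⟩

/-- Spend `c` steps. -/
def tick (c : ℕ) : Timed Unit := ⟨(), c⟩

end Timed

open Timed

/-! ### The recovery algorithm

The input is a graph `G` and an optimal solution `x` of its crude SDP. Vertex sets are kept as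
lists without repetitions. The step count charges one step for every list cell that is visited or
written, for every comparison of two vertices or two lengths, for every query to the adjacency
relation and for every operation on coordinates of the vectors. -/

open Classical in
/-- Is `v` equal or adjacent to some member of the list? -/
def conflicts {n : ℕ} (G : SimpleGraph (Fin n)) (v : Fin n) : List (Fin n) → Timed Bool
  | [] => do
      tick 1
      return false
  | w :: l => do
      tick 3
      if v = w ∨ G.Adj v w then return true else conflicts G v l

open Classical in
/-- The sublist of those vertices whose vectors are at distance less than `1` from the vector
of `u`. One evaluation of a squared distance in `ℝⁿ` and its comparison with `1` take `n`
subtractions, `n` multiplications, `n` additions and one comparison. -/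
def ball {n : ℕ} (x : Fin n → EuclideanSpace ℝ (Fin n)) (u : Fin n) :
    List (Fin n) → Timed (List (Fin n))
  | [] => do
      tick 1
      return []
  | v :: l => do
      let r ← ball x u l
      tick (3 * n + 3)
      if dist (x u) (x v) < 1 then return v :: r else return r

/-- The greedy step: run through the given vertices and add to the current set every vertex which
is not in it and has no neighbour in it. -/
def extend {n : ℕ} (G : SimpleGraph (Fin n)) :
    List (Fin n) → List (Fin n) → Timed (List (Fin n))
  | [], cur => do
      tick 1
      return cur
  | v :: l, cur => do
      let b ← conflicts G v cur
      tick 2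
      if b then extend G l cur else extend G l (v :: cur)

/-- Are the members of the list pairwise distinct and nonadjacent? -/
def checkIndep {n : ℕ} (G : SimpleGraph (Fin n)) : List (Fin n) → Timed Bool
  | [] => do
      tick 1
      return true
  | v :: l => do
      let b ← conflicts G v l
      tick 1
      if b then return false else checkIndep G l

/-- The candidate set of the vertex `u`: the ball of radius `1` around its vector, extended by the
greedy step. -/
def candidate {n : ℕ} (G : SimpleGraph (Fin n)) (x : Fin n → EuclideanSpace ℝ (Fin n))
    (u : Fin n) : Timed (List (Fin n)) := do
  let B ← ball x u (List.finRange n)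
  extend G (List.finRange n) B

/-- Run through the given centres and keep the largest candidate set which is independent
in `G`; the first list is the list of centres, the second one is the best set found so far. -/
def best {n : ℕ} (G : SimpleGraph (Fin n)) (x : Fin n → EuclideanSpace ℝ (Fin n)) :
    List (Fin n) → List (Fin n) → Timed (List (Fin n))
  | [], cur => do
      tick 1
      return cur
  | u :: l, cur => do
      let C ← candidate G x u
      let ok ← checkIndep G C
      tick (C.length + cur.length + 2)
      if ok ∧ cur.length < C.length then best G x l C else best G x l cur

/-- The whole algorithm after the crude SDP has been solved: return the largest independent
candidate set over all the vertices. -/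
def recover {n : ℕ} (G : SimpleGraph (Fin n)) (x : Fin n → EuclideanSpace ℝ (Fin n)) :
    Timed (List (Fin n)) :=
  best G x (List.finRange n) []

/-- The vertex set returned by the algorithm. -/
def output {n : ℕ} (G : SimpleGraph (Fin n)) (x : Fin n → EuclideanSpace ℝ (Fin n)) :
    Finset (Fin n) :=
  (recover G x).val.toFinset

end SemiRandom

end

/-! ### Concentration of the random boundary edges -/

namespace SemiRandom

open MeasureTheory ProbabilityTheory

/-! Write `A` for the indicator matrix of `E'` on `S × Sᶜ`, `M = 1 - A / p` for its centred form,
`c` for the mean of the vectors of `S`, and `ζ = ∑ ‖x w - c‖²` over `w ∈ S`. The proof shows that an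
optimal solution clusters `S` so tightly that a single ball reveals it.

Optimality: moving all of `S` to one unit vector orthogonal to the other vectors stays feasible, so
`k ζ = ∑ (1 - ⟨x u, x v⟩)` over `S × S` is at most twice the sum of `⟨x u, x v⟩` over `S × Sᶜ`
(`IsOptimal.sum_one_sub_inner_le`). Inner products vanish along edges and the vectors `x w - c` sum
to zero, so this cross sum equals `∑ ⟨x w - c, q w⟩` with `q = M y`, where `y v` is `x v` rescaled
by less than `2` (`sum_inner_eq`). By Cauchy–Schwarz, `ζ` reappears on the right under a square
root; a bound `∑ ‖q w‖² = O(n² / p)` then gives `k² ζ = O(n² / p)`, that is, `ζ ≤ p k / 64` once `k³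
p²` is a large multiple of `n²`.

Randomness: the adversary's vectors depend on `E'`, so the bound on `M y` must be uniform. For one
sign vector it fails with probability at most `12 ^ n * exp (-5 n)`, apart from rows of exceptional
degree (`prob_rowSum_sq_gt_le`), which permits a union bound over all signs; a Grothendieck-type
argument (`vecBound_of_signs`) passes from signs to vectors.

Recovery: some `u ∈ S` lies close to `c`. Every `v ∉ S` has more than `p k / 2` neighbours in `S`,
too many for all to be far from `c`, so one of them is close to `x u`. Being orthogonal to that
neighbour, `x v` is at distance more than `1` from `x u`. Hence the ball around `x u` lies in `S`
and blocks every outside vertex, and the greedy step fills up `S`. -/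

/-- The expectation of a product of functions of the individual coordinates of a random set. -/
lemma integral_prod_setBernoulli {ι : Type*} [Fintype ι] (u : Set ι) (p : unitInterval)
    (f : ι → Prop → ℝ) :
    ∫ E, ∏ i, f i (i ∈ E) ∂(setBernoulli u p) =
      ∏ i, ((p : ℝ) * f i (i ∈ u) + (1 - p) * f i False) := by
  classical
  rw [setBernoulli_eq_map, Measure.infinitePi_eq_pi]
  rw [integral_map (Measurable.of_discrete.aemeasurable) (Measurable.of_discrete.aestronglyMeasurable)]
  simp only [Set.mem_ofPred_eq]
  rw [integral_fintype_prod_eq_prod]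
  refine Finset.prod_congr rfl fun i _ => ?_
  rw [integral_add_measure, integral_smul_nnreal_measure, integral_smul_nnreal_measure]
  · simp [NNReal.smul_def]
  · exact .of_finite
  · exact .of_finite

/-- Markov's inequality; `F` will be a normalized exponential moment. -/
lemma measureReal_le_of_one_le {ι : Type*} [Finite ι] (u : Set ι) (p : unitInterval)
    (s : Set (Set ι)) (F : Set ι → ℝ) (h0 : ∀ E, 0 ≤ F E) (h1 : ∀ E ∈ s, 1 ≤ F E) :
    (setBernoulli u p).real s ≤ ∫ E, F E ∂(setBernoulli u p) := by
  rw [← integral_indicator_one (MeasurableSet.of_discrete)]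
  refine integral_mono .of_finite .of_finite fun E => ?_
  by_cases h : E ∈ s
  · simpa [h] using h1 E h
  · simpa [h] using h0 E

/-- The expectation of a product over distinct elements of the ground set. -/
lemma integral_prod_setBernoulli_of_injOn {ι κ : Type*} [Fintype ι] (u : Set ι)
    (p : unitInterval) (F : Finset κ) (e : κ → ι) (he : Set.InjOn e F) (hu : ∀ k ∈ F, e k ∈ u)
    (g : κ → Prop → ℝ) :
    ∫ E, ∏ k ∈ F, g k (e k ∈ E) ∂(setBernoulli u p) =
      ∏ k ∈ F, ((p : ℝ) * g k True + (1 - p) * g k False) := by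
  classical
  -- Coordinate `i` carries the factor of the index `k` with `e k = i`, and `1` if there is none.
  have key := integral_prod_setBernoulli u p
    (fun i P => ∏ k ∈ F, if e k = i then g k P else 1)
  have h1 : ∀ E : Set ι, ∏ i, (∏ k ∈ F, if e k = i then g k (i ∈ E) else 1) =
      ∏ k ∈ F, g k (e k ∈ E) := by
    intro E
    rw [Finset.prod_comm]
    refine Finset.prod_congr rfl fun k _ => ?_
    simp
  simp only [h1] at key
  rw [key, ← Finset.prod_subset (Finset.subset_univ (F.image e)), Finset.prod_image he]
  · refine Finset.prod_congr rfl fun k hk => ?_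
    have h2 : ∀ P : Prop, (∏ l ∈ F, if e l = e k then g l P else 1) = g k P := by
      intro P
      rw [Finset.prod_eq_single_of_mem k hk]
      · simp
      · intro l hl hlk
        rw [if_neg fun h => hlk (he hl hk h)]
    rw [h2, h2]
    simp [hu k hk]
  · intro i _ hi
    have h2 : ∀ P : Prop, (∏ l ∈ F, if e l = i then g l P else 1) = 1 := by
      intro P
      refine Finset.prod_eq_one fun l hl => ?_
      rw [if_neg fun h => hi (Finset.mem_image.2 ⟨l, hl, h⟩)]
    rw [h2, h2]
    ring

open Classical in
/-- The indicator of the presence of an edge. -/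
noncomputable def edgeInd {n : ℕ} (E : Set (Sym2 (Fin n))) (w v : Fin n) : ℝ := if s(w, v) ∈ E then 1 else 0

/-- The centred and normalized indicator `1 - A / p`. -/
noncomputable def centred {n : ℕ} (p : ℝ) (E : Set (Sym2 (Fin n))) (w v : Fin n) : ℝ := 1 - edgeInd E w v / p

lemma integral_prod_boundaryLaw {n : ℕ} (S : Finset (Fin n)) (p : unitInterval)
    (F : Finset (Fin n × Fin n)) (hF : F ⊆ S ×ˢ Sᶜ) (g : Fin n × Fin n → ℝ → ℝ) :
    ∫ E, ∏ k ∈ F, g k (edgeInd E k.1 k.2) ∂(boundaryLaw S p) =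
      ∏ k ∈ F, ((p : ℝ) * g k 1 + (1 - p) * g k 0) := by
  classical
  have h := integral_prod_setBernoulli_of_injOn (boundary S) p F (fun k => s(k.1, k.2))
    (by
      rintro ⟨a, b⟩ hab ⟨c, d⟩ hcd h
      have h1 := hF hab
      have h2 := hF hcd
      simp only [Finset.mem_product, Finset.mem_compl] at h1 h2
      simp only [Sym2.eq_iff] at h
      rcases h with ⟨rfl, rfl⟩ | ⟨rfl, rfl⟩
      · rfl
      · exact absurd h1.1 h2.2)
    (by
      rintro ⟨a, b⟩ hab
      have h1 := hF hab
      simp only [Finset.mem_product, Finset.mem_compl] at h1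
      exact ⟨a, h1.1, b, h1.2, rfl⟩)
    (fun k P => g k (if P then 1 else 0))
  simpa [boundaryLaw, edgeInd] using h

lemma exp_le_one_add_add_sq {x : ℝ} (hx : |x| ≤ 1) : Real.exp x ≤ 1 + x + x ^ 2 := by
  have := (abs_le.1 (Real.abs_exp_sub_one_sub_id_le hx)).2
  linarith

/-- The entries have size up to `1 / p`, so `|t| ≤ p` is what keeps both exponents in `[-1, 1]`,
where `exp x ≤ 1 + x + x²`. The linear terms cancel and the variance is `1 / p - 1`. -/
lemma mgf_centred_bernoulli_le {p t : ℝ} (hp : 0 < p) (hp1 : p ≤ 1) (ht : |t| ≤ p) :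
    p * Real.exp (t * (1 - 1 / p)) + (1 - p) * Real.exp (t * (1 - 0 / p)) ≤
      Real.exp (t ^ 2 / p) := by
  have h1 : |t * (1 - 1 / p)| ≤ 1 := by
    have : t * (1 - 1 / p) = -(t / p) * (1 - p) := by field_simp; ring
    rw [this, abs_mul, abs_neg, abs_div, abs_of_pos hp, abs_of_nonneg (by linarith : 0 ≤ 1 - p)]
    have : |t| / p ≤ 1 := (div_le_one hp).2 ht
    have h0 : 0 ≤ |t| / p := by positivity
    nlinarith
  have h2 : |t * (1 - 0 / p)| ≤ 1 := by simpa using ht.trans hp1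
  have e1 := mul_le_mul_of_nonneg_left (exp_le_one_add_add_sq h1) hp.le
  have e2 := mul_le_mul_of_nonneg_left (exp_le_one_add_add_sq h2) (by linarith : 0 ≤ 1 - p)
  have e3 := Real.add_one_le_exp (t ^ 2 / p)
  have e4 : p * (1 + t * (1 - 1 / p) + (t * (1 - 1 / p)) ^ 2) +
      (1 - p) * (1 + t * (1 - 0 / p) + (t * (1 - 0 / p)) ^ 2) = t ^ 2 / p + 1 - t ^ 2 := by
    field_simp
    ring
  nlinarith [sq_nonneg t]

/-- The signed sum over the row of `w` of the centred matrix. -/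
noncomputable def rowSum {n : ℕ} (S : Finset (Fin n)) (p : ℝ) (ε : Fin n → ℝ) (E : Set (Sym2 (Fin n)))
    (w : Fin n) : ℝ := ∑ v ∈ Sᶜ, centred p E w v * ε v

/-- The exponent may vary with the row, because expanding a product of mixtures over the rows picks
a different exponent in each. -/
lemma mgf_rowSum_le {n : ℕ} (S : Finset (Fin n)) (p : unitInterval) (hp : 0 < p)
    (ε : Fin n → ℝ) (hε : ∀ v, |ε v| ≤ 1) (s : Fin n → ℝ) (hs : ∀ w, |s w| ≤ p) :
    ∫ E, ∏ w ∈ S, Real.exp (s w * rowSum S p ε E w) ∂(boundaryLaw S p) ≤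
      ∏ w ∈ S, Real.exp ((s w) ^ 2 * (n / p)) := by
  have hp' : (0 : ℝ) < p := hp
  have h := integral_prod_boundaryLaw S p (S ×ˢ Sᶜ) subset_rfl
    (fun k a => Real.exp (s k.1 * ε k.2 * (1 - a / p)))
  have h1 : ∀ E : Set (Sym2 (Fin n)), ∏ k ∈ S ×ˢ Sᶜ,
      Real.exp (s k.1 * ε k.2 * (1 - edgeInd E k.1 k.2 / p)) =
        ∏ w ∈ S, Real.exp (s w * rowSum S p ε E w) := by
    intro E
    rw [Finset.prod_product]
    refine Finset.prod_congr rfl fun w _ => ?_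
    rw [← Real.exp_sum, rowSum, Finset.mul_sum]
    congr 1
    refine Finset.sum_congr rfl fun v _ => ?_
    simp only [centred]; ring
  simp only [h1] at h
  rw [h, Finset.prod_product]
  refine Finset.prod_le_prod (fun w _ => Finset.prod_nonneg fun v _ => ?_) fun w _ => ?_
  · have : 0 ≤ 1 - (p : ℝ) := by linarith [p.2.2]
    positivity
  · have h2 : ∀ v ∈ Sᶜ, (p : ℝ) * Real.exp (s w * ε v * (1 - 1 / p)) +
        (1 - p) * Real.exp (s w * ε v * (1 - 0 / p)) ≤ Real.exp ((s w) ^ 2 / p) := by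
      intro v _
      have hle : |s w * ε v| ≤ |s w| := by
        rw [abs_mul]; exact mul_le_of_le_one_right (abs_nonneg _) (hε v)
      refine (mgf_centred_bernoulli_le hp' p.2.2 (hle.trans (hs w))).trans ?_
      refine Real.exp_le_exp.2 (div_le_div_of_nonneg_right (sq_le_sq.2 hle) hp'.le)
    have h0 : 0 ≤ 1 - (p : ℝ) := by linarith [p.2.2]
    refine (Finset.prod_le_prod (fun v _ => by positivity) h2).trans ?_
    rw [Finset.prod_const, ← Real.exp_nat_mul]
    refine Real.exp_le_exp.2 ?_
    have h3 : (Sᶜ.card : ℝ) ≤ n := by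
      exact_mod_cast (Finset.card_le_univ _).trans (by simp)
    have : (s w) ^ 2 * (n / p) = n * ((s w) ^ 2 / p) := by ring
    rw [this]
    exact mul_le_mul_of_nonneg_right h3 (by positivity)

/-- A mixture of exponential moments is bounded by the mixture of the bounds. -/
lemma integral_prod_mixture_le {n : ℕ} {ι : Type*} (S : Finset (Fin n)) (p : unitInterval)
    (hp : 0 < p) (ε : Fin n → ℝ) (hε : ∀ v, |ε v| ≤ 1) (T : Finset ι) (a s : ι → ℝ)
    (ha : ∀ i, 0 ≤ a i) (hs : ∀ i ∈ T, |s i| ≤ p) :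
    ∫ E, ∏ w ∈ S, ∑ i ∈ T, a i * Real.exp (s i * rowSum S p ε E w) ∂(boundaryLaw S p) ≤
      (∑ i ∈ T, a i * Real.exp ((s i) ^ 2 * (n / p))) ^ S.card := by
  classical
  have : IsProbabilityMeasure (boundaryLaw S p) := by unfold boundaryLaw; infer_instance
  have h : ∀ E : Set (Sym2 (Fin n)),
      ∏ w ∈ S, ∑ i ∈ T, a i * Real.exp (s i * rowSum S p ε E w) =
        ∑ x ∈ S.pi (fun _ => T), (∏ w ∈ S.attach, a (x w.1 w.2)) *
          ∏ w ∈ S.attach, Real.exp (s (x w.1 w.2) * rowSum S p ε E w) := by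
    intro E
    rw [Finset.prod_sum]
    simp_rw [Finset.prod_mul_distrib]
  simp_rw [h]
  rw [integral_finsetSum _ fun _ _ => .of_finite]
  have h2 : (∑ i ∈ T, a i * Real.exp ((s i) ^ 2 * (n / p))) ^ S.card =
      ∑ x ∈ S.pi (fun _ => T), (∏ w ∈ S.attach, a (x w.1 w.2)) *
          ∏ w ∈ S.attach, Real.exp ((s (x w.1 w.2)) ^ 2 * (n / p)) := by
    rw [← Finset.prod_const, Finset.prod_sum]
    simp_rw [Finset.prod_mul_distrib]
  rw [h2]
  refine Finset.sum_le_sum fun x hx => ?_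
  rw [integral_const_mul]
  refine mul_le_mul_of_nonneg_left ?_ (Finset.prod_nonneg fun _ _ => ha _)
  have h3 := mgf_rowSum_le S p hp ε hε (fun w => if hw : w ∈ S then s (x w hw) else 0)
    (fun w => by
      by_cases hw : w ∈ S
      · simpa [hw] using hs _ (Finset.mem_pi.1 hx w hw)
      · simpa [hw] using p.2.1)
  have h4 : ∀ f : Fin n → ℝ → ℝ, ∏ w ∈ S, f w (if hw : w ∈ S then s (x w hw) else 0) =
      ∏ w ∈ S.attach, f w.1 (s (x w.1 w.2)) := by
    intro f
    rw [← Finset.prod_attach]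
    refine Finset.prod_congr rfl fun w _ => ?_
    simp [w.2]
  rw [h4 fun w y => Real.exp (y ^ 2 * (n / p))] at h3
  refine le_trans (le_of_eq ?_) h3
  refine integral_congr_ae (.of_forall fun E => ?_)
  exact (h4 fun w y => Real.exp (y * rowSum S p ε E w)).symm

/-- The weights of a discretized Gaussian mixture of exponentials. -/
noncomputable def mixWeight (i : Bool × ℕ) : ℝ := Real.exp (1 - 2 * (i.2 : ℝ) ^ 2)

/-- The exponents of a discretized Gaussian mixture of exponentials. -/
def mixShift (i : Bool × ℕ) : ℝ := (if i.1 then 1 else -1) * (i.2 : ℝ)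

/-- A Gaussian average of the exponentials `exp (s y)` is an exponential of `y²`. Here it is
discretized to integer `s` and cut off at `|s| ≤ M`, as the moment bounds hold only for small
exponents; a single term already suffices. -/
lemma exp_sq_le_mixture {M y : ℝ} (hM : 0 ≤ M) (hy : |y| ≤ 4 * M) :
    Real.exp (y ^ 2 / 64) ≤ ∑ i ∈ Finset.univ ×ˢ Finset.range (⌊M⌋₊ + 1),
      mixWeight i * Real.exp (mixShift i * y) := by
  set j := ⌊|y| / 8⌋₊ with hj
  have hjM : j ∈ Finset.range (⌊M⌋₊ + 1) := by
    rw [Finset.mem_range, Nat.lt_succ_iff]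
    exact Nat.floor_le_floor (by linarith [abs_nonneg y])
  have hj1 : (j : ℝ) ≤ |y| / 8 := Nat.floor_le (by positivity)
  have hj2 : |y| / 8 < j + 1 := Nat.lt_floor_add_one _
  -- For `j = 0` one has `|y| < 8`, and the summand `1` suffices; for `j ≥ 1`, `|y|` lies between `8
  -- j` and `16 j`.
  have hexp : y ^ 2 / 64 ≤ (1 - 2 * (j : ℝ) ^ 2) + j * |y| := by
    rw [← sq_abs y]
    have h0 := abs_nonneg y
    rcases Nat.eq_zero_or_pos j with h | h
    · rw [h] at hj2 ⊢
      norm_num at hj2 ⊢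
      nlinarith [sq_abs y]
    · have h1 : (1 : ℝ) ≤ j := by exact_mod_cast h
      nlinarith
  obtain ⟨b, hb⟩ : ∃ b : Bool, mixShift (b, j) * y = j * |y| := by
    rcases le_total 0 y with h | h
    · exact ⟨true, by simp [mixShift, abs_of_nonneg h]⟩
    · exact ⟨false, by simp [mixShift, abs_of_nonpos h]⟩
  refine le_trans ?_ (Finset.single_le_sum (f := fun i => mixWeight i * Real.exp (mixShift i * y))
    (fun i _ => by unfold mixWeight; positivity) (Finset.mk_mem_product (Finset.mem_univ b) hjM))
  simp only [hb]
  rw [mixWeight, ← Real.exp_add]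
  exact Real.exp_le_exp.2 hexp

/-- The weight `exp (1 - 2 j²)` beats the moment `exp (j²)`, leaving at most `e / 2 ^ j` for each
sign; `4 e < 12`. -/
lemma sum_mixWeight_le (J : ℕ) :
    ∑ i ∈ Finset.univ ×ˢ Finset.range J, mixWeight i * Real.exp ((mixShift i) ^ 2) ≤ 12 := by
  have h : ∀ i : Bool × ℕ, mixWeight i * Real.exp ((mixShift i) ^ 2) ≤
      2.7182818286 * (1 / 2 : ℝ) ^ i.2 := by
    rintro ⟨b, j⟩
    have h1 : (mixShift (b, j)) ^ 2 = (j : ℝ) ^ 2 := by cases b <;> simp [mixShift]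
    rw [h1, mixWeight, ← Real.exp_add]
    have h2 : (1 - 2 * (j : ℝ) ^ 2) + (j : ℝ) ^ 2 ≤ 1 + j * (-1) := by
      have : (j : ℝ) ≤ (j : ℝ) ^ 2 := by exact_mod_cast Nat.le_self_pow (by norm_num) j
      linarith
    refine (Real.exp_le_exp.2 h2).trans ?_
    rw [Real.exp_add, Real.exp_nat_mul]
    have h3 : Real.exp (-1) ≤ 1 / 2 := by
      rw [Real.exp_neg, one_div]
      exact inv_anti₀ (by norm_num) (by linarith [Real.exp_one_gt_d9])
    exact mul_le_mul Real.exp_one_lt_d9.le (pow_le_pow_left₀ (Real.exp_pos _).le h3 _)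
      (by positivity) (by norm_num)
  refine (Finset.sum_le_sum fun i _ => h i).trans ?_
  rw [Finset.sum_product]
  simp only [Finset.sum_const, Finset.card_univ, Fintype.card_bool, ← Finset.mul_sum]
  have h4 : ∑ j ∈ Finset.range J, (1 / 2 : ℝ) ^ j ≤ 2 := sum_geometric_two_le J
  simp only [nsmul_eq_mul]
  push_cast
  linarith

/-- For fixed signs it is exponentially unlikely that the rows are moderate but have a large
sum of squares. -/
lemma prob_rowSum_sq_gt_le {n : ℕ} (S : Finset (Fin n)) (p : unitInterval)
    (hp : 0 < p) (hpn : 1 ≤ (p : ℝ) * n) (ε : Fin n → ℝ) (hε : ∀ v, |ε v| ≤ 1) :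
    (boundaryLaw S p).real {E | (∀ w ∈ S, |rowSum S p ε E w| ≤ 4 * n) ∧
      320 * (n : ℝ) ^ 2 / p ≤ ∑ w ∈ S, (rowSum S p ε E w) ^ 2} ≤
      12 ^ n * Real.exp (-(5 * n)) := by
  have hp' : (0 : ℝ) < p := hp
  have hn : (0 : ℝ) < n := by
    rcases (Nat.cast_nonneg n : (0 : ℝ) ≤ n).eq_or_lt with h | h
    · rw [← h] at hpn; norm_num at hpn
    · exact h
  -- `τ` normalizes a row to variance of order one. Since `M τ = p`, the cutoff `M` is exactly the
  -- range of admissible exponents, and rows of size at most `4 n` become at most `4 M`.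
  set τ : ℝ := √(p / n) with hτ
  set M : ℝ := √(p * n) with hM
  have hτsq : τ ^ 2 = p / n := Real.sq_sqrt (by positivity)
  have hMsq : M ^ 2 = p * n := Real.sq_sqrt (by positivity)
  have hτ0 : 0 ≤ τ := Real.sqrt_nonneg _
  have hM0 : 0 ≤ M := Real.sqrt_nonneg _
  have hnτ : n * τ = M := by
    rw [← sq_eq_sq₀ (by positivity) hM0, mul_pow, hτsq, hMsq]; field_simp
  have hMτ : M * τ = p := by
    rw [← sq_eq_sq₀ (by positivity) hp'.le, mul_pow, hτsq, hMsq]; field_simp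
  set T : Finset (Bool × ℕ) := Finset.univ ×ˢ Finset.range (⌊M⌋₊ + 1) with hT
  refine (measureReal_le_of_one_le _ _ _ (fun E => Real.exp (-(5 * n)) *
    ∏ w ∈ S, ∑ i ∈ T, mixWeight i * Real.exp (mixShift i * τ * rowSum S p ε E w)) ?_ ?_).trans ?_
  · intro E
    have : ∀ i, 0 ≤ mixWeight i := fun i => by unfold mixWeight; positivity
    exact mul_nonneg (Real.exp_pos _).le (Finset.prod_nonneg fun w _ => Finset.sum_nonneg
      fun i _ => mul_nonneg (this i) (Real.exp_pos _).le)
  · rintro E ⟨hE1, hE2⟩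
    have h1 : ∀ w ∈ S, Real.exp ((τ * rowSum S p ε E w) ^ 2 / 64) ≤
        ∑ i ∈ T, mixWeight i * Real.exp (mixShift i * τ * rowSum S p ε E w) := by
      intro w hw
      have := exp_sq_le_mixture hM0 (y := τ * rowSum S p ε E w) (by
        rw [abs_mul, abs_of_nonneg hτ0, ← hnτ]
        nlinarith [hE1 w hw])
      simpa only [mul_assoc] using this
    have h2 := Finset.prod_le_prod (fun w _ => (Real.exp_pos _).le) h1
    rw [← Real.exp_sum] at h2
    refine le_trans ?_ (mul_le_mul_of_nonneg_left h2 (Real.exp_pos _).le)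
    rw [← Real.exp_add]
    refine Real.one_le_exp ?_
    simp only [mul_pow, hτsq]
    rw [← Finset.sum_div, ← Finset.mul_sum]
    -- The threshold turns into the exponent `320 n / 64 = 5 n`.
    have h3 : (p : ℝ) / n * (320 * (n : ℝ) ^ 2 / p) = 320 * n := by field_simp
    have h4 := mul_le_mul_of_nonneg_left hE2 (by positivity : 0 ≤ (p : ℝ) / n)
    linarith
  · rw [integral_const_mul, mul_comm]
    refine mul_le_mul_of_nonneg_right ?_ (Real.exp_pos _).le
    refine (integral_prod_mixture_le S p hp ε hε T mixWeight (fun i => mixShift i * τ)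
      (fun i => by unfold mixWeight; positivity) fun i hi => ?_).trans ?_
    · rw [abs_mul, abs_of_nonneg hτ0, ← hMτ]
      refine mul_le_mul_of_nonneg_right ?_ hτ0
      have h1 : |mixShift i| = i.2 := by
        rcases i with ⟨b, j⟩
        cases b <;> simp [mixShift]
      rw [h1]
      have h2 := (Finset.mem_product.1 hi).2
      rw [Finset.mem_range, Nat.lt_succ_iff] at h2
      exact (Nat.le_floor_iff hM0).1 h2
    · have h1 : ∀ i, (mixShift i * τ) ^ 2 * (n / p) = (mixShift i) ^ 2 := by
        intro i
        rw [mul_pow, hτsq]; field_simp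
      simp only [h1]
      have h0 : 0 ≤ ∑ i ∈ T, mixWeight i * Real.exp ((mixShift i) ^ 2) :=
        Finset.sum_nonneg fun i _ => by unfold mixWeight; positivity
      refine (pow_le_pow_left₀ h0 (sum_mixWeight_le _) _).trans ?_
      refine pow_le_pow_right₀ (by norm_num) ?_
      simpa using Finset.card_le_univ S

/-- A lower tail bound for the degrees into `S`. -/
lemma prob_degree_lt_le {n : ℕ} (S : Finset (Fin n)) (p : unitInterval) (v : Fin n)
    (hv : v ∉ S) :
    (boundaryLaw S p).real {E | ∑ w ∈ S, edgeInd E w v ≤ p * S.card / 2} ≤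
      Real.exp (-(p * S.card / 10)) := by
  have hp0 : (0 : ℝ) ≤ p := p.2.1
  have hp1 : (p : ℝ) ≤ 1 := p.2.2
  have h := integral_prod_boundaryLaw S p (S ×ˢ {v})
    (Finset.product_subset_product_right (by simpa using hv)) (fun k a => Real.exp (-a))
  simp only [Finset.prod_product, Finset.prod_singleton, Finset.prod_const,
    Finset.card_product, Finset.card_singleton, mul_one] at h
  simp only [← Real.exp_sum, Finset.sum_neg_distrib] at h
  refine (measureReal_le_of_one_le _ _ _ (fun E => Real.exp (p * S.card / 2) *
    Real.exp (-∑ w ∈ S, edgeInd E w v)) (fun E => by positivity) ?_).trans ?_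
  · intro E hE
    rw [← Real.exp_add]
    exact Real.one_le_exp (by simpa using hE)
  · rw [integral_const_mul]
    change _ * ∫ E, _ ∂(boundaryLaw S p) ≤ _
    rw [h]
    have h3 : Real.exp (-1) ≤ 2 / 5 := by
      rw [Real.exp_neg]
      rw [inv_le_comm₀ (Real.exp_pos _) (by norm_num)]
      linarith [Real.exp_one_gt_d9]
    have h4 : (p : ℝ) * Real.exp (-1) + (1 - p) * Real.exp (-0) ≤ Real.exp (-(p * (3 / 5))) := by
      have := Real.add_one_le_exp (-((p : ℝ) * (3 / 5)))
      simp only [neg_zero, Real.exp_zero]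
      nlinarith
    have h5 : 0 ≤ (p : ℝ) * Real.exp (-1) + (1 - p) * Real.exp (-0) := by
      have : 0 ≤ 1 - (p : ℝ) := by linarith
      positivity
    refine (mul_le_mul_of_nonneg_left (pow_le_pow_left₀ h5 h4 _) (Real.exp_pos _).le).trans ?_
    rw [← Real.exp_nat_mul, ← Real.exp_add]
    refine Real.exp_le_exp.2 ?_
    linarith

/-- An upper tail bound for the degrees out of `S`. -/
lemma prob_degree_gt_le {n : ℕ} (S : Finset (Fin n)) (p : unitInterval) (w : Fin n)
    (hw : w ∈ S) :
    (boundaryLaw S p).real {E | 3 * ((p : ℝ) * n) ≤ ∑ v ∈ Sᶜ, edgeInd E w v} ≤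
      Real.exp (-(p * n)) := by
  have hp0 : (0 : ℝ) ≤ p := p.2.1
  have hp1 : (p : ℝ) ≤ 1 := p.2.2
  have h := integral_prod_boundaryLaw S p ({w} ×ˢ Sᶜ)
    (Finset.product_subset_product_left (by simpa using hw)) (fun k a => Real.exp a)
  simp only [Finset.prod_product, Finset.prod_singleton, Finset.prod_const,
    Finset.card_product, Finset.card_singleton, one_mul] at h
  simp only [← Real.exp_sum] at h
  refine (measureReal_le_of_one_le _ _ _ (fun E => Real.exp (-(3 * (p * n))) *
    Real.exp (∑ v ∈ Sᶜ, edgeInd E w v)) (fun E => by positivity) ?_).trans ?_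
  · intro E hE
    rw [← Real.exp_add]
    refine Real.one_le_exp ?_
    simp only [Set.mem_ofPred_eq] at hE
    linarith
  · rw [integral_const_mul]
    change _ * ∫ E, _ ∂(boundaryLaw S p) ≤ _
    rw [h]
    have h4 : (p : ℝ) * Real.exp 1 + (1 - p) * Real.exp 0 ≤ Real.exp (2 * p) := by
      have := Real.add_one_le_exp (2 * (p : ℝ))
      simp only [Real.exp_zero]
      nlinarith [Real.exp_one_lt_d9]
    have h5 : 0 ≤ (p : ℝ) * Real.exp 1 + (1 - p) * Real.exp 0 := by
      have : 0 ≤ 1 - (p : ℝ) := by linarith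
      positivity
    refine (mul_le_mul_of_nonneg_left (pow_le_pow_left₀ h5 h4 _) (Real.exp_pos _).le).trans ?_
    rw [← Real.exp_nat_mul, ← Real.exp_add]
    refine Real.exp_le_exp.2 ?_
    have h6 : (Sᶜ.card : ℝ) ≤ n := by
      exact_mod_cast (Finset.card_le_univ _).trans (by simp)
    nlinarith

/-- The pseudorandomness of the boundary edges on which the analysis rests: large degrees into `S`
and a bound for the signed sums of the rows of the centred matrix. -/
def IsPseudorandom {n : ℕ} (S : Finset (Fin n)) (p : ℝ) (E : Set (Sym2 (Fin n))) : Prop :=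
  (∀ v ∉ S, p * S.card / 2 < ∑ w ∈ S, edgeInd E w v) ∧
  ∀ A : Finset (Fin n),
    ∑ w ∈ S, (rowSum S p (fun v => if v ∈ A then 1 else -1) E w) ^ 2 ≤ 320 * (n : ℝ) ^ 2 / p

lemma edgeInd_nonneg {n : ℕ} (E : Set (Sym2 (Fin n))) (w v : Fin n) : 0 ≤ edgeInd E w v := by
  unfold edgeInd; split_ifs <;> norm_num

/-- Rows of moderate degree fall within the range of the truncated mixture. -/
lemma abs_rowSum_le {n : ℕ} (S : Finset (Fin n)) {p : ℝ} (hp : 0 < p) (ε : Fin n → ℝ)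
    (hε : ∀ v, |ε v| ≤ 1) (E : Set (Sym2 (Fin n))) (w : Fin n)
    (h : ∑ v ∈ Sᶜ, edgeInd E w v < 3 * (p * n)) : |rowSum S p ε E w| ≤ 4 * n := by
  have h1 : |rowSum S p ε E w| ≤ ∑ v ∈ Sᶜ, (1 + edgeInd E w v / p) := by
    refine (Finset.abs_sum_le_sum_abs _ _).trans (Finset.sum_le_sum fun v _ => ?_)
    rw [abs_mul]
    refine (mul_le_of_le_one_right (abs_nonneg _) (hε v)).trans ?_
    have := div_nonneg (edgeInd_nonneg E w v) hp.le
    rw [centred, abs_le]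
    constructor <;> linarith
  refine h1.trans ?_
  rw [Finset.sum_add_distrib, ← Finset.sum_div]
  have h2 : (∑ v ∈ Sᶜ, edgeInd E w v) / p ≤ 3 * n := by
    rw [div_le_iff₀ hp]; linarith
  have h3 : ∑ v ∈ Sᶜ, (1 : ℝ) ≤ n := by
    simpa using (Finset.card_le_univ Sᶜ)
  linarith

lemma prob_not_isPseudorandom_le {n : ℕ} (S : Finset (Fin n)) (p : unitInterval)
    (hp : 0 < p) (hpn : 1 ≤ (p : ℝ) * n) :
    (boundaryLaw S p).real {E | ¬ IsPseudorandom S p E} ≤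
      n * Real.exp (-(p * S.card / 10)) + n * Real.exp (-(p * n)) +
        2 ^ n * (12 ^ n * Real.exp (-(5 * n))) := by
  have hp' : (0 : ℝ) < p := hp
  have : IsProbabilityMeasure (boundaryLaw S p) := by unfold boundaryLaw; infer_instance
  set B1 : Fin n → Set (Set (Sym2 (Fin n))) :=
    fun v => {E | ∑ w ∈ S, edgeInd E w v ≤ p * S.card / 2}
  set B2 : Fin n → Set (Set (Sym2 (Fin n))) :=
    fun w => {E | 3 * ((p : ℝ) * n) ≤ ∑ v ∈ Sᶜ, edgeInd E w v}
  set sg : Finset (Fin n) → Fin n → ℝ := fun A v => if v ∈ A then 1 else -1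
  have hsg : ∀ A v, |sg A v| ≤ 1 := by
    intro A v
    simp only [sg]; split_ifs <;> simp
  set B3 : Finset (Fin n) → Set (Set (Sym2 (Fin n))) :=
    fun A => {E | (∀ w ∈ S, |rowSum S p (sg A) E w| ≤ 4 * n) ∧
      320 * (n : ℝ) ^ 2 / p ≤ ∑ w ∈ S, (rowSum S p (sg A) E w) ^ 2}
  have hsub : {E | ¬ IsPseudorandom S p E} ⊆
      ((⋃ v ∈ Sᶜ, B1 v) ∪ ⋃ w ∈ S, B2 w) ∪ ⋃ A ∈ (Finset.univ : Finset (Finset (Fin n))), B3 A := by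
    intro E hE
    by_contra hcon
    simp only [Set.mem_union, Set.mem_iUnion, not_or, not_exists, Finset.mem_compl] at hcon
    obtain ⟨⟨h1, h2⟩, h3⟩ := hcon
    refine hE ⟨fun v hv => ?_, fun A => ?_⟩
    · simpa [B1] using h1 v hv
    · have h4 := h3 A (Finset.mem_univ _)
      simp only [B3, Set.mem_ofPred_eq, not_and, not_le] at h4
      exact (h4 fun w hw => abs_rowSum_le S hp' _ (hsg A) E w (by simpa [B2] using h2 w hw)).le
  refine (measureReal_mono hsub).trans ((measureReal_union_le _ _).trans (add_le_add
    ((measureReal_union_le _ _).trans (add_le_add ?_ ?_)) ?_))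
  · refine (measureReal_biUnion_finset_le _ _).trans ((Finset.sum_le_card_nsmul _ _ _
      fun v hv => prob_degree_lt_le S p v (by simpa using hv)).trans ?_)
    rw [nsmul_eq_mul]
    refine mul_le_mul_of_nonneg_right ?_ (Real.exp_pos _).le
    exact_mod_cast (Finset.card_le_univ _).trans (by simp)
  · refine (measureReal_biUnion_finset_le _ _).trans ((Finset.sum_le_card_nsmul _ _ _
      fun w hw => prob_degree_gt_le S p w hw).trans ?_)
    rw [nsmul_eq_mul]
    refine mul_le_mul_of_nonneg_right ?_ (Real.exp_pos _).le
    exact_mod_cast (Finset.card_le_univ _).trans (by simp)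
  · refine (measureReal_biUnion_finset_le _ _).trans ((Finset.sum_le_card_nsmul _ _ _
      fun A _ => prob_rowSum_sq_gt_le S p hp hpn (sg A) (hsg A)).trans ?_)
    rw [nsmul_eq_mul]
    simp

/-- The pseudorandomness fails with small probability. -/
lemma eventually_prob_isPseudorandom {δ : ℝ} (hδ : 0 < δ) : ∃ N : ℕ, ∀ n : ℕ, N ≤ n →
    ∀ (p : unitInterval) (S : Finset (Fin n)), 0 < p → √n ≤ p * S.card →
      1 - δ ≤ (boundaryLaw S p).real {E | IsPseudorandom S p E} := by
  have hlim : Filter.Tendsto (fun n : ℕ => 2 * ((√(n : ℝ)) ^ 2 * Real.exp (-(1 / 10) * √n)) +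
      Real.exp (-(n : ℝ))) Filter.atTop (nhds (2 * 0 + 0)) := by
    have h1 : Filter.Tendsto (fun n : ℕ => √(n : ℝ)) Filter.atTop Filter.atTop :=
      Real.tendsto_sqrt_atTop.comp tendsto_natCast_atTop_atTop
    have h2 := (tendsto_rpow_mul_exp_neg_mul_atTop_nhds_zero 2 (1 / 10) (by norm_num)).comp h1
    simp only [Real.rpow_two] at h2
    have h3 := Real.tendsto_exp_neg_atTop_nhds_zero.comp
      (tendsto_natCast_atTop_atTop (R := ℝ))
    exact (h2.const_mul 2).add h3
  rw [mul_zero, add_zero] at hlim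
  obtain ⟨N, hN⟩ := Filter.eventually_atTop.1 (hlim.eventually_le_const hδ)
  refine ⟨max N 1, fun n hn p S hp hpk => ?_⟩
  have : IsProbabilityMeasure (boundaryLaw S p) := by unfold boundaryLaw; infer_instance
  have hp' : (0 : ℝ) < p := hp
  have hn1 : (1 : ℝ) ≤ n := by exact_mod_cast (le_max_right _ _).trans hn
  have hcard : (S.card : ℝ) ≤ n := by
    exact_mod_cast (Finset.card_le_univ _).trans (by simp)
  have hpn : √n ≤ p * n := hpk.trans (mul_le_mul_of_nonneg_left hcard hp'.le)
  have hsq1 : 1 ≤ √(n : ℝ) := Real.one_le_sqrt.2 hn1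
  have h1 := prob_not_isPseudorandom_le S p hp (hsq1.trans hpn)
  have h2 : (boundaryLaw S p).real {E | ¬ IsPseudorandom S p E} =
      1 - (boundaryLaw S p).real {E | IsPseudorandom S p E} := by
    rw [← probReal_compl_eq_one_sub (MeasurableSet.of_discrete)]
    rfl
  have h3 : Real.exp (-(p * S.card / 10)) ≤ Real.exp (-(1 / 10) * √n) :=
    Real.exp_le_exp.2 (by linarith)
  have h4 : Real.exp (-(p * n : ℝ)) ≤ Real.exp (-(1 / 10) * √n) :=
    Real.exp_le_exp.2 (by linarith)
  -- The exponent `5 n` was chosen so that `24 ≤ e⁴` leaves `exp (-n)` after the union bound over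
  -- all signs.
  have h5 : (2 : ℝ) ^ n * (12 ^ n * Real.exp (-(5 * n))) ≤ Real.exp (-n) := by
    rw [← mul_assoc, ← mul_pow]
    have : (2 * 12 : ℝ) ≤ Real.exp 4 := by
      have h := Real.exp_one_gt_d9
      have h' : Real.exp 4 = (Real.exp 1) ^ 4 := by rw [← Real.exp_nat_mul]; norm_num
      rw [h']
      calc (2 * 12 : ℝ) ≤ 2.7 ^ 4 := by norm_num
        _ ≤ _ := pow_le_pow_left₀ (by norm_num) (by linarith) 4
    refine (mul_le_mul_of_nonneg_right (pow_le_pow_left₀ (by norm_num) this n)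
      (Real.exp_pos _).le).trans ?_
    rw [← Real.exp_nat_mul, ← Real.exp_add]
    exact Real.exp_le_exp.2 (by linarith)
  have h6 := hN n ((le_max_left _ _).trans hn)
  rw [Real.sq_sqrt (by positivity)] at h6
  have h7 := mul_le_mul_of_nonneg_left h3 (by positivity : (0 : ℝ) ≤ n)
  have h8 := mul_le_mul_of_nonneg_left h4 (by positivity : (0 : ℝ) ≤ n)
  linarith

end SemiRandom

/-! ### From signs to vectors: a Grothendieck-type inequality -/

namespace SemiRandom

/-- The sign encoded by a Boolean. -/
def boolSign (b : Bool) : ℝ := if b then 1 else -1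

lemma sum_boolPi_succ {d : ℕ} (F : (Fin (d + 1) → Bool) → ℝ) :
    ∑ ξ, F ξ = ∑ ξ : Fin d → Bool, (F (Fin.cons true ξ) + F (Fin.cons false ξ)) := by
  rw [← (Fin.consEquiv (fun _ => Bool)).sum_comp, Fintype.sum_prod_type, Fintype.sum_bool,
    ← Finset.sum_add_distrib]
  rfl

lemma sum_rademacher_sq {d : ℕ} (a : Fin d → ℝ) :
    ∑ ξ : Fin d → Bool, (∑ i, a i * boolSign (ξ i)) ^ 2 = 2 ^ d * ∑ i, a i ^ 2 := by
  induction d with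
  | zero => simp
  | succ d ih =>
    rw [sum_boolPi_succ]
    simp only [Fin.sum_univ_succ, Fin.cons_zero, Fin.cons_succ]
    have h := ih (fun i => a i.succ)
    calc _ = ∑ ξ : Fin d → Bool, (2 * a 0 ^ 2 +
          2 * (∑ i : Fin d, a i.succ * boolSign (ξ i)) ^ 2) := by
          refine Finset.sum_congr rfl fun ξ _ => ?_
          simp only [boolSign, if_true, Bool.false_eq_true, if_false]; ring
      _ = _ := by
          simp only [Finset.sum_add_distrib, ← Finset.mul_sum, h]
          simp
          ring

/-- Averaging over the first sign kills the odd powers, leaving a recursion in the second and fourth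
moments. -/
lemma sum_rademacher_pow_four_le {d : ℕ} (a : Fin d → ℝ) :
    ∑ ξ : Fin d → Bool, (∑ i, a i * boolSign (ξ i)) ^ 4 ≤ 2 ^ d * (3 * (∑ i, a i ^ 2) ^ 2) := by
  induction d with
  | zero => simp
  | succ d ih =>
    rw [sum_boolPi_succ]
    simp only [Fin.sum_univ_succ, Fin.cons_zero, Fin.cons_succ]
    have h := ih (fun i => a i.succ)
    have h2 := sum_rademacher_sq (fun i => a i.succ)
    calc _ = ∑ ξ : Fin d → Bool, (2 * a 0 ^ 4 +
          12 * a 0 ^ 2 * (∑ i : Fin d, a i.succ * boolSign (ξ i)) ^ 2 +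
          2 * (∑ i : Fin d, a i.succ * boolSign (ξ i)) ^ 4) := by
          refine Finset.sum_congr rfl fun ξ _ => ?_
          simp only [boolSign, if_true, Bool.false_eq_true, if_false]; ring
      _ ≤ _ := by
          simp only [Finset.sum_add_distrib, ← Finset.mul_sum, h2, Finset.sum_const, Finset.card_univ, Fintype.card_fun, Fintype.card_bool,
            Fintype.card_fin, nsmul_eq_mul, Nat.cast_pow, Nat.cast_ofNat]
          have h3 : (0 : ℝ) ≤ 2 ^ d * (a 0 ^ 2) ^ 2 := by positivity
          rw [pow_succ (2 : ℝ) d]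
          nlinarith

variable {W V : Type*} [Fintype W] [Fintype V]

/-- `C` bounds the squared norm of the image under `B` of every family of vectors of norm at most
one, in every dimension. -/
def VecBound (B : W → V → ℝ) (C : ℝ) : Prop :=
  ∀ (d : ℕ) (x : V → Fin d → ℝ), (∀ v, ∑ i, x v i ^ 2 ≤ 1) →
    ∑ w, ∑ i, (∑ v, B w v * x v i) ^ 2 ≤ C

lemma VecBound.scale {B : W → V → ℝ} {C : ℝ} (h : VecBound B C) {ι : Type*} [Fintype ι]
    {r : ℝ} (hr : 0 < r) (x : V → ι → ℝ) (hx : ∀ v, ∑ i, x v i ^ 2 ≤ r) :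
    ∑ w, ∑ i, (∑ v, B w v * x v i) ^ 2 ≤ C * r := by
  have h1 := h (Fintype.card ι) (fun v i => x v ((Fintype.equivFin ι).symm i) / √r) (by
    intro v
    simp only [div_pow, Real.sq_sqrt hr.le, ← Finset.sum_div]
    rw [(Fintype.equivFin ι).symm.sum_comp (fun i => x v i ^ 2)]
    exact (div_le_one hr).2 (hx v))
  have h2 : ∀ w, ∑ i, (∑ v, B w v * (x v ((Fintype.equivFin ι).symm i) / √r)) ^ 2 =
      (∑ i, (∑ v, B w v * x v i) ^ 2) / r := by
    intro w
    rw [(Fintype.equivFin ι).symm.sum_comp (fun i => (∑ v, B w v * (x v i / √r)) ^ 2),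
      Finset.sum_div]
    refine Finset.sum_congr rfl fun i _ => ?_
    simp only [← mul_div_assoc, ← Finset.sum_div, div_pow, Real.sq_sqrt hr.le]
  simp only [h2, ← Finset.sum_div] at h1
  exact (div_le_iff₀ hr).1 h1

/-- Only the existence of some finite bound matters: it starts the iteration. -/
lemma vecBound_frobenius (B : W → V → ℝ) :
    VecBound B (∑ w, (∑ v, B w v ^ 2) * Fintype.card V) := by
  intro d x hx
  refine Finset.sum_le_sum fun w _ => ?_
  calc ∑ i, (∑ v, B w v * x v i) ^ 2 ≤ ∑ i, (∑ v, B w v ^ 2) * ∑ v, x v i ^ 2 :=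
        Finset.sum_le_sum fun i _ => Finset.sum_mul_sq_le_sq_mul_sq _ _ _
    _ = (∑ v, B w v ^ 2) * ∑ v, ∑ i, x v i ^ 2 := by rw [← Finset.mul_sum, Finset.sum_comm]
    _ ≤ _ := by
        refine mul_le_mul_of_nonneg_left ?_ (Finset.sum_nonneg fun _ _ => sq_nonneg _)
        simpa using Finset.sum_le_sum fun v (_ : v ∈ Finset.univ) => hx v

/-- Truncation of a real number to `[-1, 1]`. -/
def clip (t : ℝ) : ℝ := max (-1) (min 1 t)

lemma abs_clip_le (t : ℝ) : |clip t| ≤ 1 :=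
  abs_le.2 ⟨le_max_left _ _, max_le (by norm_num) (min_le_left _ _)⟩

/-- The excess `|t| - 1` is at most `t² / 4`, because `(|t| - 2)² ≥ 0`. -/
lemma sub_clip_sq_le (t : ℝ) : (t - clip t) ^ 2 ≤ t ^ 4 / 16 := by
  have h : |t - clip t| ≤ t ^ 2 / 4 := by
    unfold clip
    rcases le_total t 1 with h1 | h1
    · rw [min_eq_right h1]
      rcases le_total (-1) t with h2 | h2
      · rw [max_eq_right h2]; simp; positivity
      · rw [max_eq_left h2, abs_le]; constructor <;> nlinarith [sq_nonneg (t + 2)]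
    · rw [min_eq_left h1, max_eq_right (by norm_num), abs_le]
      constructor <;> nlinarith [sq_nonneg (t - 2)]
  calc (t - clip t) ^ 2 = |t - clip t| ^ 2 := (sq_abs _).symm
    _ ≤ (t ^ 2 / 4) ^ 2 := pow_le_pow_left₀ (abs_nonneg _) h 2
    _ = _ := by ring

/-- Random signs embed the vectors isometrically as functions on the cube. Their truncations to
`[-1, 1]` are controlled pointwise by `K`. The remainders have mean square at most `3 / 16` by the
fourth moment, so the old bound, used in dimension `2 ^ d`, costs only a fraction of `C`. -/
lemma VecBound.improve {B : W → V → ℝ} {C K : ℝ} (h : VecBound B C)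
    (hK : ∀ ε : V → ℝ, (∀ v, |ε v| ≤ 1) → ∑ w, (∑ v, B w v * ε v) ^ 2 ≤ K) :
    VecBound B (2 * K + 3 / 8 * C) := by
  intro d x hx
  set H : V → (Fin d → Bool) → ℝ := fun v ξ => ∑ i, x v i * boolSign (ξ i) with hH
  have h2d : (0 : ℝ) < 2 ^ d := by positivity
  have h1 : 2 ^ d * ∑ w, ∑ i, (∑ v, B w v * x v i) ^ 2 =
      ∑ w, ∑ ξ : Fin d → Bool, (∑ v, B w v * H v ξ) ^ 2 := by
    rw [Finset.mul_sum]
    refine Finset.sum_congr rfl fun w _ => ?_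
    rw [← sum_rademacher_sq]
    refine Finset.sum_congr rfl fun ξ _ => ?_
    congr 1
    simp only [hH, Finset.mul_sum, Finset.sum_mul]
    rw [Finset.sum_comm]
    simp only [mul_assoc]
  have h3 : ∀ w ξ, (∑ v, B w v * H v ξ) ^ 2 ≤ 2 * (∑ v, B w v * clip (H v ξ)) ^ 2 +
      2 * (∑ v, B w v * (H v ξ - clip (H v ξ))) ^ 2 := by
    intro w ξ
    have : ∑ v, B w v * H v ξ =
        ∑ v, B w v * clip (H v ξ) + ∑ v, B w v * (H v ξ - clip (H v ξ)) := by
      rw [← Finset.sum_add_distrib]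
      exact Finset.sum_congr rfl fun v _ => by ring
    rw [this]
    nlinarith [sq_nonneg (∑ v, B w v * clip (H v ξ) - ∑ v, B w v * (H v ξ - clip (H v ξ)))]
  have h4 : ∑ w, ∑ ξ : Fin d → Bool, (∑ v, B w v * clip (H v ξ)) ^ 2 ≤ 2 ^ d * K := by
    rw [Finset.sum_comm]
    refine (Finset.sum_le_sum fun ξ _ => hK _ fun v => abs_clip_le (H v ξ)).trans ?_
    simp
  have h5 : ∑ w, ∑ ξ : Fin d → Bool, (∑ v, B w v * (H v ξ - clip (H v ξ))) ^ 2 ≤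
      C * (2 ^ d * (3 / 16)) := by
    refine h.scale (by positivity) _ fun v => ?_
    refine (Finset.sum_le_sum fun ξ _ => sub_clip_sq_le (H v ξ)).trans ?_
    rw [← Finset.sum_div]
    have h6 := sum_rademacher_pow_four_le (x v)
    have h7 : (∑ i, x v i ^ 2) ^ 2 ≤ 1 :=
      pow_le_one₀ (Finset.sum_nonneg fun _ _ => sq_nonneg _) (hx v)
    have h8 := mul_le_mul_of_nonneg_left h7 h2d.le
    linarith
  have h9 := Finset.sum_le_sum fun w (_ : w ∈ Finset.univ) =>
    Finset.sum_le_sum fun ξ (_ : ξ ∈ Finset.univ) => h3 w ξ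
  simp only [Finset.sum_add_distrib, ← Finset.mul_sum] at h9
  rw [← h1] at h9
  refine le_of_mul_le_mul_left ?_ h2d
  linarith

/-- A Grothendieck inequality for positive semidefinite forms: a bound for all signed sums extends
to unit vectors at the cost of a constant factor. -/
lemma vecBound_of_signs {B : W → V → ℝ} {K : ℝ}
    (hK : ∀ ε : V → ℝ, (∀ v, |ε v| ≤ 1) → ∑ w, (∑ v, B w v * ε v) ^ 2 ≤ K) :
    VecBound B (4 * K) := by
  have hK0 : 0 ≤ K := by simpa using hK 0 (by simp)
  obtain ⟨C, hC⟩ : ∃ C, VecBound B C := ⟨_, vecBound_frobenius B⟩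
  -- Since `2 K + 3 / 8 * (4 K) ≤ 4 K`, each improvement shrinks the excess over `4 K` by `3 / 8`.
  have h : ∀ m : ℕ, VecBound B (4 * K + (3 / 8) ^ m * C) := by
    intro m
    induction m with
    | zero =>
      intro d x hx
      have := hC d x hx
      simp only [pow_zero, one_mul]
      linarith
    | succ m ih =>
      intro d x hx
      have := ih.improve hK d x hx
      rw [pow_succ]
      linarith
  intro d x hx
  have hlim : Filter.Tendsto (fun m : ℕ => 4 * K + (3 / 8 : ℝ) ^ m * C) Filter.atTop
      (nhds (4 * K + 0 * C)) :=
    ((tendsto_pow_atTop_nhds_zero_of_lt_one (by norm_num) (by norm_num)).mul_const C).const_add _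
  rw [zero_mul, add_zero] at hlim
  exact ge_of_tendsto' hlim fun m => h m d x hx

/-- A bound for all signs is a bound for all coefficients in `[-1, 1]`. -/
lemma sum_sq_le_of_signs [DecidableEq V] {B : W → V → ℝ} {K : ℝ}
    (hK : ∀ A : Finset V, ∑ w, (∑ v, B w v * (if v ∈ A then 1 else -1)) ^ 2 ≤ K)
    (ε : V → ℝ) (hε : ∀ v, |ε v| ≤ 1) : ∑ w, (∑ v, B w v * ε v) ^ 2 ≤ K := by
  have hconv : ConvexOn ℝ Set.univ (fun ε : V → ℝ => ∑ w, (∑ v, B w v * ε v) ^ 2) := by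
    have h1 : ∀ w : W, ConvexOn ℝ Set.univ (fun ε : V → ℝ => (∑ v, B w v * ε v) ^ 2) := by
      intro w
      have h2 : ConvexOn ℝ Set.univ (fun t : ℝ => t ^ 2) := even_two.convexOn_pow
      refine ⟨convex_univ, fun x _ y _ a b ha hb hab => ?_⟩
      have h3 := h2.2 (Set.mem_univ (∑ v, B w v * x v)) (Set.mem_univ (∑ v, B w v * y v)) ha hb hab
      refine le_trans (le_of_eq ?_) h3
      simp only [smul_eq_mul, Pi.add_apply, Pi.smul_apply, Finset.mul_sum,
        ← Finset.sum_add_distrib]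
      congr 1
      exact Finset.sum_congr rfl fun v _ => by ring
    refine ⟨convex_univ, fun x hx y hy a b ha hb hab => ?_⟩
    simp only [smul_eq_mul, Finset.mul_sum, ← Finset.sum_add_distrib]
    exact Finset.sum_le_sum fun w _ => by
      simpa only [smul_eq_mul, Finset.mul_sum] using (h1 w).2 hx hy ha hb hab
  -- A convex function on the cube is bounded by its value at some vertex.
  have hmem : ε ∈ convexHull ℝ (Set.univ.pi fun _ : V => ({-1, 1} : Set ℝ)) := by
    rw [convexHull_pi]
    intro v _
    rw [convexHull_pair, segment_eq_Icc (by norm_num)]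
    exact abs_le.1 (hε v)
  obtain ⟨σ, hσ, hle⟩ := hconv.exists_ge_of_mem_convexHull (Set.subset_univ _) hmem
  refine hle.trans ?_
  refine le_trans (le_of_eq ?_) (hK (Finset.univ.filter fun v => σ v = 1))
  refine Finset.sum_congr rfl fun w _ => ?_
  congr 1
  refine Finset.sum_congr rfl fun v _ => ?_
  have h := hσ v (Set.mem_univ v)
  simp only [Finset.mem_filter, Finset.mem_univ, true_and]
  rcases h with h | h
  · rw [h]; norm_num
  · rw [Set.mem_singleton_iff] at h; rw [h]; simp

end SemiRandom

/-! ### Step count and correctness of the recovery algorithm -/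

namespace SemiRandom

section Algorithm

variable {n : ℕ} (G : SimpleGraph (Fin n)) (x : Fin n → EuclideanSpace ℝ (Fin n))

lemma Timed.bind_val {α β : Type} (m : Timed α) (f : α → Timed β) :
    (m >>= f).val = (f m.val).val := rfl

lemma Timed.bind_steps {α β : Type} (m : Timed α) (f : α → Timed β) :
    (m >>= f).steps = m.steps + (f m.val).steps := rfl

lemma Timed.pure_val {α : Type} (a : α) : (pure a : Timed α).val = a := rfl

lemma Timed.pure_steps {α : Type} (a : α) : (pure a : Timed α).steps = 0 := rfl

lemma Timed.tick_steps (c : ℕ) : (Timed.tick c).steps = c := rfl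

lemma Timed.ite_val {α : Type} (c : Prop) [Decidable c] (a b : Timed α) :
    (if c then a else b).val = if c then a.val else b.val := by split_ifs <;> rfl

lemma Timed.ite_steps {α : Type} (c : Prop) [Decidable c] (a b : Timed α) :
    (if c then a else b).steps = if c then a.steps else b.steps := by split_ifs <;> rfl

lemma conflicts_val (v : Fin n) (l : List (Fin n)) :
    (conflicts G v l).val = true ↔ ∃ w ∈ l, v = w ∨ G.Adj v w := by
  induction l with
  | nil => simp [conflicts, Timed.bind_val, Timed.pure_val]
  | cons w l ih =>
    by_cases h : v = w ∨ G.Adj v w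
    · simp [conflicts, Timed.bind_val, Timed.pure_val, h]
    · simp [conflicts, Timed.bind_val, h, ih]

lemma conflicts_steps (v : Fin n) (l : List (Fin n)) :
    (conflicts G v l).steps ≤ 3 * l.length + 1 := by
  induction l with
  | nil => simp [conflicts, Timed.bind_steps, Timed.pure_steps, Timed.tick_steps]
  | cons w l ih =>
    rw [conflicts, Timed.bind_steps, Timed.tick_steps, Timed.ite_steps, List.length_cons]
    split_ifs
    · rw [Timed.pure_steps]; omega
    · omega

lemma ball_val (u : Fin n) (l : List (Fin n)) [DecidablePred fun v => dist (x u) (x v) < 1] :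
    (ball x u l).val = l.filter (fun v => dist (x u) (x v) < 1) := by
  induction l with
  | nil => rfl
  | cons v l ih =>
    rw [ball, Timed.bind_val, Timed.bind_val, Timed.ite_val, Timed.pure_val, Timed.pure_val, ih]
    by_cases h : dist (x u) (x v) < 1 <;> simp [h]

lemma length_ball_le (u : Fin n) (l : List (Fin n)) : (ball x u l).val.length ≤ l.length := by
  classical
  rw [ball_val]
  exact List.length_filter_le _ _

lemma ball_steps (u : Fin n) (l : List (Fin n)) :
    (ball x u l).steps ≤ (3 * n + 3) * l.length + 1 := by
  induction l with
  | nil => simp [ball, Timed.bind_steps, Timed.pure_steps, Timed.tick_steps]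
  | cons v l ih =>
    rw [ball, Timed.bind_steps, Timed.bind_steps, Timed.ite_steps, Timed.pure_steps,
      Timed.pure_steps, Timed.tick_steps, ite_self, List.length_cons]
    linarith

lemma extend_cons_val (v : Fin n) (l cur : List (Fin n)) :
    (extend G (v :: l) cur).val =
      if (conflicts G v cur).val then (extend G l cur).val else (extend G l (v :: cur)).val := by
  rw [extend, Timed.bind_val, Timed.bind_val, Timed.ite_val]

lemma length_extend_le (l cur : List (Fin n)) :
    (extend G l cur).val.length ≤ l.length + cur.length := by
  induction l generalizing cur with
  | nil => simp [extend, Timed.bind_val, Timed.pure_val]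
  | cons v l ih =>
    rw [extend_cons_val, List.length_cons]
    split_ifs
    · linarith [ih cur]
    · have := ih (v :: cur)
      rw [List.length_cons] at this
      linarith

lemma extend_steps (l cur : List (Fin n)) :
    (extend G l cur).steps ≤ l.length * (3 * (l.length + cur.length) + 3) + 1 := by
  induction l generalizing cur with
  | nil => simp [extend, Timed.bind_steps, Timed.pure_steps, Timed.tick_steps]
  | cons v l ih =>
    rw [extend, Timed.bind_steps, Timed.bind_steps, Timed.ite_steps, Timed.tick_steps,
      List.length_cons]
    have h1 := conflicts_steps G v cur
    split_ifs
    · nlinarith [ih cur]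
    · have := ih (v :: cur)
      rw [List.length_cons] at this
      nlinarith

lemma checkIndep_val (l : List (Fin n)) : (checkIndep G l).val = true ↔
    l.Pairwise fun v w => ¬ (v = w ∨ G.Adj v w) := by
  induction l with
  | nil => simp [checkIndep, Timed.bind_val, Timed.pure_val]
  | cons v l ih =>
    rw [checkIndep, Timed.bind_val, Timed.bind_val, Timed.ite_val, Timed.pure_val,
      List.pairwise_cons, ← ih]
    by_cases h : (conflicts G v l).val = true
    · have h' := (conflicts_val G v l).1 h
      simp only [h, if_true, Bool.false_eq_true, false_iff, not_and]
      obtain ⟨w, hw, hvw⟩ := h'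
      exact fun hall => absurd hvw (hall w hw)
    · have h' : ¬ ∃ w ∈ l, v = w ∨ G.Adj v w := fun h' => h ((conflicts_val G v l).2 h')
      simp only [h, Bool.false_eq_true, if_false]
      exact ⟨fun hi => ⟨fun w hw hvw => h' ⟨w, hw, hvw⟩, hi⟩, fun hi => hi.2⟩

lemma checkIndep_steps (l : List (Fin n)) :
    (checkIndep G l).steps ≤ l.length * (3 * l.length + 2) + 1 := by
  induction l with
  | nil => simp [checkIndep, Timed.bind_steps, Timed.pure_steps, Timed.tick_steps]
  | cons v l ih =>
    rw [checkIndep, Timed.bind_steps, Timed.bind_steps, Timed.ite_steps, Timed.tick_steps,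
      List.length_cons, Timed.pure_steps]
    have h1 := conflicts_steps G v l
    split_ifs <;> nlinarith

/-- The crude `2 n`, without using that the list has no repetitions, is enough for the step count.
-/
lemma length_candidate_le (u : Fin n) : (candidate G x u).val.length ≤ 2 * n := by
  rw [candidate, Timed.bind_val]
  have h1 := length_extend_le G (List.finRange n) (ball x u (List.finRange n)).val
  have h2 := length_ball_le x u (List.finRange n)
  rw [List.length_finRange] at h1 h2
  omega

lemma candidate_steps (u : Fin n) : (candidate G x u).steps ≤ 9 * n ^ 2 + 6 * n + 2 := by
  rw [candidate, Timed.bind_steps]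
  have h1 := ball_steps x u (List.finRange n)
  have h2 := extend_steps G (List.finRange n) (ball x u (List.finRange n)).val
  have h3 := length_ball_le x u (List.finRange n)
  rw [List.length_finRange] at h1 h2 h3
  nlinarith

lemma best_cons_val (u : Fin n) (l cur : List (Fin n)) :
    (best G x (u :: l) cur).val =
      if (checkIndep G (candidate G x u).val).val ∧ cur.length < (candidate G x u).val.length then
        (best G x l (candidate G x u).val).val else (best G x l cur).val := by
  rw [best, Timed.bind_val, Timed.bind_val, Timed.bind_val, Timed.ite_val]

lemma best_steps (l cur : List (Fin n)) (hcur : cur.length ≤ 2 * n) :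
    (best G x l cur).steps ≤ l.length * (21 * n ^ 2 + 14 * n + 5) + 1 := by
  induction l generalizing cur with
  | nil => simp [best, Timed.bind_steps, Timed.pure_steps, Timed.tick_steps]
  | cons u l ih =>
    rw [best, Timed.bind_steps, Timed.bind_steps, Timed.bind_steps, Timed.ite_steps,
      Timed.tick_steps, List.length_cons]
    have h1 := candidate_steps G x u
    have h2 := length_candidate_le G x u
    have h3 := checkIndep_steps G (candidate G x u).val
    have h4 : (checkIndep G (candidate G x u).val).steps ≤ 2 * n * (3 * (2 * n) + 2) + 1 :=
      h3.trans (by gcongr)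
    split_ifs
    · have := ih _ h2
      nlinarith
    · have := ih _ hcur
      nlinarith

lemma recover_steps : (recover G x).steps ≤ n * (21 * n ^ 2 + 14 * n + 5) + 1 := by
  have := best_steps G x (List.finRange n) [] (by simp)
  rwa [List.length_finRange] at this

lemma best_pairwise (l cur : List (Fin n))
    (hcur : cur.Pairwise fun v w => ¬ (v = w ∨ G.Adj v w)) :
    (best G x l cur).val.Pairwise fun v w => ¬ (v = w ∨ G.Adj v w) := by
  induction l generalizing cur with
  | nil => exact hcur
  | cons u l ih =>
    rw [best_cons_val]
    split_ifs with h
    · exact ih _ ((checkIndep_val G _).1 h.1)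
    · exact ih _ hcur

lemma length_le_length_best (l cur : List (Fin n)) :
    cur.length ≤ (best G x l cur).val.length := by
  induction l generalizing cur with
  | nil => exact le_rfl
  | cons u l ih =>
    rw [best_cons_val]
    split_ifs with h
    · exact h.2.le.trans (ih _)
    · exact ih _

lemma length_candidate_le_length_best (l cur : List (Fin n)) (u : Fin n) (hu : u ∈ l)
    (hind : (candidate G x u).val.Pairwise fun v w => ¬ (v = w ∨ G.Adj v w)) :
    (candidate G x u).val.length ≤ (best G x l cur).val.length := by
  induction l generalizing cur with
  | nil => simp at hu
  | cons v l ih =>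
    rw [best_cons_val]
    rcases List.mem_cons.1 hu with rfl | hu
    · rw [(checkIndep_val G _).2 hind]
      split_ifs with h
      · exact length_le_length_best G x l _
      · have := length_le_length_best G x l cur
        simp only [true_and, not_lt] at h
        omega
    · split_ifs
      · exact ih _ hu
      · exact ih _ hu

lemma output_isIndepSet : G.IsIndepSet (output G x : Set (Fin n)) := by
  have h : (recover G x).val.Pairwise fun v w => ¬ (v = w ∨ G.Adj v w) :=
    best_pairwise G x _ _ List.Pairwise.nil
  have : Std.Symm fun v w => ¬ (v = w ∨ G.Adj v w) :=
    ⟨fun v w hvw => by rwa [eq_comm, G.adj_comm]⟩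
  intro v hv w hw hvw hadj
  simp only [output, List.coe_toFinset, Set.mem_ofPred_eq] at hv hw
  exact h.forall hv hw hvw (Or.inr hadj)

lemma card_output : (output G x).card = (recover G x).val.length := by
  have h : (recover G x).val.Pairwise fun v w => ¬ (v = w ∨ G.Adj v w) :=
    best_pairwise G x _ _ List.Pairwise.nil
  exact List.toFinset_card_of_nodup (h.imp fun h => fun e => h (Or.inl e))

/-- If the current set lies in the independent set `S` and blocks every vertex outside `S`, then
the greedy step fills up `S`. -/
lemma extend_spec (S : Finset (Fin n)) (hS : G.IsIndepSet (S : Set (Fin n)))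
    (l cur : List (Fin n)) (hnd : cur.Nodup) (hcur : ∀ v ∈ cur, v ∈ S)
    (hblock : ∀ v ∉ S, ∃ w ∈ cur, G.Adj v w) :
    (extend G l cur).val.Nodup ∧ (∀ v ∈ (extend G l cur).val, v ∈ S) ∧
      (∀ v ∈ cur, v ∈ (extend G l cur).val) ∧ ∀ v ∈ l, v ∈ S → v ∈ (extend G l cur).val := by
  induction l generalizing cur with
  | nil => exact ⟨hnd, hcur, fun v hv => hv, by simp⟩
  | cons u l ih =>
    rw [extend_cons_val]
    by_cases hc : (conflicts G u cur).val = true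
    · rw [if_pos hc]
      obtain ⟨h1, h2, h3, h4⟩ := ih cur hnd hcur hblock
      refine ⟨h1, h2, h3, fun v hv hvS => ?_⟩
      rcases List.mem_cons.1 hv with rfl | hv
      · obtain ⟨w, hw, hvw⟩ := (conflicts_val G v cur).1 hc
        rcases hvw with rfl | hvw
        · exact h3 _ hw
        · exact absurd hvw (hS hvS (hcur w hw) hvw.ne)
      · exact h4 v hv hvS
    · rw [if_neg hc]
      have hc' : ¬ ∃ w ∈ cur, u = w ∨ G.Adj u w := fun h => hc ((conflicts_val G u cur).2 h)
      have huS : u ∈ S := by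
        by_contra h
        obtain ⟨w, hw, huw⟩ := hblock u h
        exact hc' ⟨w, hw, Or.inr huw⟩
      obtain ⟨h1, h2, h3, h4⟩ := ih (u :: cur)
        (List.nodup_cons.2 ⟨fun h => hc' ⟨u, h, Or.inl rfl⟩, hnd⟩)
        (fun v hv => by
          rcases List.mem_cons.1 hv with rfl | hv
          · exact huS
          · exact hcur v hv)
        (fun v hv => by
          obtain ⟨w, hw, hvw⟩ := hblock v hv
          exact ⟨w, List.mem_cons_of_mem _ hw, hvw⟩)
      refine ⟨h1, h2, fun v hv => h3 v (List.mem_cons_of_mem _ hv), fun v hv hvS => ?_⟩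
      rcases List.mem_cons.1 hv with rfl | hv
      · exact h3 v (List.mem_cons_self ..)
      · exact h4 v hv hvS

/-- The algorithm succeeds if the ball around some vertex lies in `S` and blocks every vertex
outside `S`. -/
lemma card_le_card_output (S : Finset (Fin n)) (hS : G.IsIndepSet (S : Set (Fin n))) (u : Fin n)
    (hball : ∀ v, dist (x u) (x v) < 1 → v ∈ S)
    (hblock : ∀ v ∉ S, ∃ w, dist (x u) (x w) < 1 ∧ G.Adj v w) :
    S.card ≤ (output G x).card := by
  classical
  obtain ⟨h1, h2, -, h4⟩ := extend_spec G S hS (List.finRange n)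
    (ball x u (List.finRange n)).val
    (by rw [ball_val]; exact (List.nodup_finRange n).filter _)
    (fun v hv => by
      rw [ball_val, List.mem_filter] at hv
      exact hball v (by simpa using hv.2))
    (fun v hv => by
      obtain ⟨w, hw, hvw⟩ := hblock v hv
      refine ⟨w, ?_, hvw⟩
      rw [ball_val, List.mem_filter]
      exact ⟨List.mem_finRange w, by simpa using hw⟩)
  change (candidate G x u).val.Nodup at h1
  change ∀ v ∈ (candidate G x u).val, v ∈ S at h2
  change ∀ v ∈ List.finRange n, v ∈ S → v ∈ (candidate G x u).val at h4
  have h5 : S.card ≤ (candidate G x u).val.length := by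
    rw [← List.toFinset_card_of_nodup h1]
    exact Finset.card_le_card fun v hv => List.mem_toFinset.2 (h4 v (List.mem_finRange v) hv)
  rw [card_output]
  refine h5.trans (length_candidate_le_length_best G x _ _ u (List.mem_finRange u) ?_)
  refine (List.Nodup.pairwise_of_forall_ne h1 fun v hv w hw hvw => ?_)
  rintro (h | h)
  · exact hvw h
  · exact hS (h2 v hv) (h2 w hw) hvw h

end Algorithm

end SemiRandom

/-! ### Existence and optimality for the crude SDP -/

namespace SemiRandom

section Program

variable {n : ℕ}

lemma IsFeasible.norm_eq_one {G : SimpleGraph (Fin n)} {x : Fin n → EuclideanSpace ℝ (Fin n)}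
    (hx : IsFeasible G x) (v : Fin n) : ‖x v‖ = 1 := by
  rw [← Real.sqrt_sq (norm_nonneg (x v)), hx.norm_sq_eq_one, Real.sqrt_one]

lemma exists_isOptimal (G : SimpleGraph (Fin n)) : ∃ x, IsOptimal G x := by
  have hcont : ∀ u v : Fin n, Continuous fun x : Fin n → EuclideanSpace ℝ (Fin n) =>
      (inner ℝ (x u) (x v) : ℝ) := fun u v =>
    (continuous_apply u).inner (continuous_apply v)
  have hset : {x | IsFeasible G x} = (⋂ u, {x | ‖x u‖ ^ 2 = 1}) ∩
      ((⋂ u, ⋂ v, {x | (0 : ℝ) ≤ inner ℝ (x u) (x v)}) ∩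
        ⋂ u, ⋂ v, ⋂ _ : G.Adj u v, {x | (inner ℝ (x u) (x v) : ℝ) = 0}) := by
    ext x
    simp only [Set.mem_inter_iff, Set.mem_iInter, Set.mem_ofPred_eq]
    exact ⟨fun h => ⟨h.1, h.2, h.3⟩, fun h => ⟨h.1, h.2.1, h.2.2⟩⟩
  have hclosed : IsClosed {x | IsFeasible G x} := by
    rw [hset]
    refine (isClosed_iInter fun u => isClosed_eq ?_ continuous_const).inter
      ((isClosed_iInter fun u => isClosed_iInter fun v =>
        isClosed_le continuous_const (hcont u v)).inter
      (isClosed_iInter fun u => isClosed_iInter fun v => isClosed_iInter fun _ =>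
        isClosed_eq (hcont u v) continuous_const))
    exact ((continuous_apply u).norm).pow 2
  have hcompact : IsCompact {x | IsFeasible G x} := by
    refine (isCompact_closedBall (0 : Fin n → EuclideanSpace ℝ (Fin n)) 1).of_isClosed_subset
      hclosed fun x hx => ?_
    rw [mem_closedBall_zero_iff, pi_norm_le_iff_of_nonneg zero_le_one]
    intro u
    have := hx.norm_sq_eq_one u
    exact (sq_le_one_iff₀ (norm_nonneg _)).1 this.le
  -- The standard orthonormal basis is feasible for every graph.
  have hne : {x | IsFeasible G x}.Nonempty := by
    refine ⟨fun u => EuclideanSpace.single u 1, ⟨by simp, fun u v => ?_, fun u v h => ?_⟩⟩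
    · rw [EuclideanSpace.inner_single_left]
      by_cases h : u = v <;> simp [h]
    · rw [EuclideanSpace.inner_single_left]
      simp [h.ne]
  have hobj : Continuous (objective : (Fin n → EuclideanSpace ℝ (Fin n)) → ℝ) := by
    unfold objective
    exact continuous_finsetSum _ fun u _ => continuous_finsetSum _ fun v _ =>
      (((continuous_apply u).sub (continuous_apply v)).norm).pow 2
  obtain ⟨x, hx, hmin⟩ := hcompact.exists_isMinOn hne hobj.continuousOn
  exact ⟨x, hx, fun y hy => hmin hy⟩

lemma objective_eq {G : SimpleGraph (Fin n)} {x : Fin n → EuclideanSpace ℝ (Fin n)}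
    (hx : IsFeasible G x) :
    objective x = ∑ _u : Fin n, ∑ _v : Fin n, (2 : ℝ) - 2 * ∑ u, ∑ v, inner ℝ (x u) (x v) := by
  simp only [objective, Finset.mul_sum, ← Finset.sum_sub_distrib]
  refine Finset.sum_congr rfl fun u _ => Finset.sum_congr rfl fun v _ => ?_
  rw [norm_sub_sq_real, hx.norm_sq_eq_one, hx.norm_sq_eq_one]
  ring

lemma sum_sum_eq_blocks (S : Finset (Fin n)) (f : Fin n → Fin n → ℝ)
    (hf : ∀ u v, f u v = f v u) :
    ∑ u, ∑ v, f u v = ∑ u ∈ S, ∑ v ∈ S, f u v + 2 * ∑ u ∈ S, ∑ v ∈ Sᶜ, f u v +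
      ∑ u ∈ Sᶜ, ∑ v ∈ Sᶜ, f u v := by
  simp only [← Finset.sum_add_sum_compl S, Finset.sum_add_distrib]
  have : ∑ u ∈ Sᶜ, ∑ v ∈ S, f u v = ∑ u ∈ S, ∑ v ∈ Sᶜ, f u v := by
    rw [Finset.sum_comm]
    exact Finset.sum_congr rfl fun u _ => Finset.sum_congr rfl fun v _ => hf _ _
  rw [this]
  ring

lemma exists_unit_orthogonal (S : Finset (Fin n)) (hS : S.Nonempty)
    (x : Fin n → EuclideanSpace ℝ (Fin n)) :
    ∃ e : EuclideanSpace ℝ (Fin n), ‖e‖ = 1 ∧ ∀ v ∉ S, (inner ℝ (x v) e : ℝ) = 0 := by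
  classical
  set U := Submodule.span ℝ ((Sᶜ.image x : Finset _) : Set (EuclideanSpace ℝ (Fin n)))
  -- At most `n - |S|` vectors span `U`, so `ℝⁿ` has room for `e` without an extra dimension.
  have h1 : Module.finrank ℝ U < n := by
    refine (finrank_span_finset_le_card _).trans_lt ((Finset.card_image_le).trans_lt ?_)
    rw [Finset.card_compl, Fintype.card_fin]
    have := hS.card_pos
    have := S.card_le_univ
    rw [Fintype.card_fin] at this
    omega
  have h2 : Uᗮ ≠ ⊥ := by
    intro h
    rw [Submodule.orthogonal_eq_bot_iff] at h
    rw [h, finrank_top, finrank_euclideanSpace_fin] at h1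
    exact lt_irrefl _ h1
  obtain ⟨e, he, hne⟩ := Submodule.exists_mem_ne_zero_of_ne_bot h2
  refine ⟨(‖e‖⁻¹ : ℝ) • e, norm_smul_inv_norm hne, fun v hv => ?_⟩
  rw [inner_smul_right, Submodule.inner_right_of_mem_orthogonal (Submodule.subset_span ?_) he,
    mul_zero]
  exact Finset.mem_coe.2 (Finset.mem_image_of_mem x (by simpa using hv))

/-- Comparing an optimal solution with the one in which an independent set is collapsed to a
point. -/
lemma IsOptimal.sum_one_sub_inner_le {G : SimpleGraph (Fin n)}
    {x : Fin n → EuclideanSpace ℝ (Fin n)} (hx : IsOptimal G x) (S : Finset (Fin n))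
    (hS : G.IsIndepSet (S : Set (Fin n))) :
    ∑ u ∈ S, ∑ v ∈ S, (1 - (inner ℝ (x u) (x v) : ℝ)) ≤
      2 * ∑ u ∈ S, ∑ v ∈ Sᶜ, (inner ℝ (x u) (x v) : ℝ) := by
  classical
  rcases S.eq_empty_or_nonempty with rfl | hne
  · simp
  obtain ⟨e, he, hxe⟩ := exists_unit_orthogonal S hne x
  set y : Fin n → EuclideanSpace ℝ (Fin n) := fun v => if v ∈ S then e else x v with hy
  have hyS : ∀ v ∈ S, y v = e := fun v hv => if_pos hv
  have hyS' : ∀ v ∉ S, y v = x v := fun v hv => if_neg hv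
  have hee : (inner ℝ e e : ℝ) = 1 := by rw [real_inner_self_eq_norm_sq, he]; norm_num
  have hex : ∀ v ∉ S, (inner ℝ e (x v) : ℝ) = 0 := fun v hv => by
    rw [real_inner_comm]; exact hxe v hv
  have hfeas : IsFeasible G y := by
    refine ⟨fun u => ?_, fun u v => ?_, fun u v huv => ?_⟩
    · by_cases hu : u ∈ S
      · rw [hyS u hu, he]; norm_num
      · rw [hyS' u hu]; exact hx.1.norm_sq_eq_one u
    · by_cases hu : u ∈ S <;> by_cases hv : v ∈ S
      · rw [hyS u hu, hyS v hv, hee]; norm_num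
      · rw [hyS u hu, hyS' v hv, hex v hv]
      · rw [hyS' u hu, hyS v hv, hxe u hu]
      · rw [hyS' u hu, hyS' v hv]; exact hx.1.inner_nonneg u v
    · by_cases hu : u ∈ S <;> by_cases hv : v ∈ S
      · exact absurd huv (hS hu hv huv.ne)
      · rw [hyS u hu, hyS' v hv, hex v hv]
      · rw [hyS' u hu, hyS v hv, hxe u hu]
      · rw [hyS' u hu, hyS' v hv]; exact hx.1.inner_eq_zero u v huv
  have hopt := hx.2 y hfeas
  rw [objective_eq hx.1, objective_eq hfeas,
    sum_sum_eq_blocks S (fun u v => inner ℝ (x u) (x v)) (fun u v => real_inner_comm _ _),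
    sum_sum_eq_blocks S (fun u v => inner ℝ (y u) (y v)) (fun u v => real_inner_comm _ _)] at hopt
  have h1 : ∑ u ∈ S, ∑ v ∈ S, (inner ℝ (y u) (y v) : ℝ) = ∑ u ∈ S, ∑ v ∈ S, 1 :=
    Finset.sum_congr rfl fun u hu => Finset.sum_congr rfl fun v hv => by
      rw [hyS u hu, hyS v hv, hee]
  have h2 : ∑ u ∈ S, ∑ v ∈ Sᶜ, (inner ℝ (y u) (y v) : ℝ) = 0 :=
    Finset.sum_eq_zero fun u hu => Finset.sum_eq_zero fun v hv => by
      rw [Finset.mem_compl] at hv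
      rw [hyS u hu, hyS' v hv, hex v hv]
  have h3 : ∑ u ∈ Sᶜ, ∑ v ∈ Sᶜ, (inner ℝ (y u) (y v) : ℝ) =
      ∑ u ∈ Sᶜ, ∑ v ∈ Sᶜ, (inner ℝ (x u) (x v) : ℝ) :=
    Finset.sum_congr rfl fun u hu => Finset.sum_congr rfl fun v hv => by
      rw [Finset.mem_compl] at hu hv
      rw [hyS' u hu, hyS' v hv]
  rw [h1, h2, h3] at hopt
  simp only [Finset.sum_sub_distrib]
  linarith

end Program

/-! ### Deterministic analysis on the pseudorandom event -/

section Analysis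

variable {n : ℕ} {S : Finset (Fin n)} {p : ℝ} {E : Set (Sym2 (Fin n))}

/-- The constant is `320`, times `4` for passing from signs to vectors, times `4` for squared norms
up to `4`. -/
lemma IsPseudorandom.sum_norm_sq_le (hE : IsPseudorandom S p E)
    (y : Fin n → EuclideanSpace ℝ (Fin n)) (hy : ∀ v ∉ S, ‖y v‖ ≤ 2) :
    ∑ w ∈ S, ‖∑ v ∈ Sᶜ, centred p E w v • y v‖ ^ 2 ≤ 5120 * (n : ℝ) ^ 2 / p := by
  classical
  set B : Fin n → Fin n → ℝ :=
    fun w v => if w ∈ S then (if v ∈ Sᶜ then centred p E w v else 0) else 0 with hB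
  have hrow : ∀ w ∈ S, ∀ ε : Fin n → ℝ, ∑ v, B w v * ε v = ∑ v ∈ Sᶜ, centred p E w v * ε v := by
    intro w hw ε
    simp only [hB, hw, if_true, ite_mul, zero_mul, Finset.sum_ite_mem, Finset.univ_inter]
  have hrow' : ∀ w ∉ S, ∀ ε : Fin n → ℝ, ∑ v, B w v * ε v = 0 := by
    intro w hw ε
    simp [hB, hw]
  have hsum : ∀ f : Fin n → ℝ, (∀ w ∉ S, f w = 0) → ∑ w, f w = ∑ w ∈ S, f w := by
    intro f hf
    exact (Finset.sum_subset (Finset.subset_univ S) fun w _ hw => hf w hw).symm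
  have hbound : VecBound B (4 * (320 * (n : ℝ) ^ 2 / p)) := by
    refine vecBound_of_signs (sum_sq_le_of_signs fun A => ?_)
    rw [hsum _ fun w hw => by rw [hrow' w hw]; norm_num]
    refine le_trans (le_of_eq ?_) (hE.2 A)
    exact Finset.sum_congr rfl fun w hw => by rw [hrow w hw, rowSum]
  have h := hbound.scale (r := 4) (by norm_num) (fun v i => if v ∈ S then 0 else y v i) (by
    intro v
    by_cases hv : v ∈ S
    · simp [hv]
    · simp only [hv, if_false]
      rw [← EuclideanSpace.real_norm_sq_eq]
      nlinarith [hy v hv, norm_nonneg (y v)])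
  rw [hsum _ fun w hw => by simp only [hrow' w hw]; simp] at h
  refine le_trans (le_of_eq ?_) (h.trans (le_of_eq (by ring)))
  refine Finset.sum_congr rfl fun w hw => ?_
  rw [EuclideanSpace.real_norm_sq_eq]
  refine Finset.sum_congr rfl fun i _ => ?_
  rw [hrow w hw]
  congr 1
  rw [WithLp.ofLp_sum, Finset.sum_apply]
  refine Finset.sum_congr rfl fun v hv => ?_
  rw [if_neg (Finset.mem_compl.1 hv)]
  rfl

/-- The mean of the vectors of `S`. -/
noncomputable def center (S : Finset (Fin n)) (x : Fin n → EuclideanSpace ℝ (Fin n)) :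
    EuclideanSpace ℝ (Fin n) := (S.card : ℝ)⁻¹ • ∑ w ∈ S, x w

lemma sum_sub_center (hS : S.Nonempty) (x : Fin n → EuclideanSpace ℝ (Fin n)) :
    ∑ w ∈ S, (x w - center S x) = 0 := by
  have hk : (S.card : ℝ) ≠ 0 := by exact_mod_cast hS.card_pos.ne'
  rw [Finset.sum_sub_distrib, Finset.sum_const, ← Nat.cast_smul_eq_nsmul ℝ, center, smul_smul,
    mul_inv_cancel₀ hk, one_smul, sub_self]

/-- Both sides equal `k² - k² ‖c‖²`, the vectors being unit vectors. -/
lemma card_mul_sum_norm_sub_center_sq (hS : S.Nonempty) {G : SimpleGraph (Fin n)}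
    {x : Fin n → EuclideanSpace ℝ (Fin n)} (hx : IsFeasible G x) :
    (S.card : ℝ) * ∑ w ∈ S, ‖x w - center S x‖ ^ 2 =
      ∑ u ∈ S, ∑ v ∈ S, (1 - (inner ℝ (x u) (x v) : ℝ)) := by
  have hk : (S.card : ℝ) ≠ 0 := by exact_mod_cast hS.card_pos.ne'
  have h1 : ∑ w ∈ S, x w = (S.card : ℝ) • center S x := by
    rw [center, smul_smul, mul_inv_cancel₀ hk, one_smul]
  have h2 : ∑ w ∈ S, ‖x w - center S x‖ ^ 2 = S.card - S.card * ‖center S x‖ ^ 2 := by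
    simp only [norm_sub_sq_real, hx.norm_sq_eq_one, Finset.sum_add_distrib,
      Finset.sum_sub_distrib, ← Finset.mul_sum, ← sum_inner, h1]
    rw [real_inner_smul_left, real_inner_self_eq_norm_sq]
    simp
    ring
  have h3 : ∑ u ∈ S, ∑ v ∈ S, (inner ℝ (x u) (x v) : ℝ) =
      (S.card : ℝ) ^ 2 * ‖center S x‖ ^ 2 := by
    simp only [← inner_sum, ← sum_inner, h1]
    rw [real_inner_smul_left, real_inner_smul_right, real_inner_self_eq_norm_sq]
    ring
  simp only [Finset.sum_sub_distrib, h3, h2]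
  simp
  ring

lemma Admissible.adj {G : SimpleGraph (Fin n)} (hG : Admissible S E G) {w v : Fin n}
    (hw : w ∈ S) (hv : v ∉ S) (h : s(w, v) ∈ E) : G.Adj w v :=
  hG.1 (by
    rw [SimpleGraph.fromEdgeSet_adj]
    exact ⟨h, fun e => hv (e ▸ hw)⟩)

/-- Each edge `w v` gives `⟨x w, x v⟩ = 0`, so summing `⟨x w - c, x v⟩` over the neighbours of `v`
gives `-D ⟨c, x v⟩`, with `D` the degree. The constant part of `centred` contributes nothing, as the
deviations from `c` sum to zero. Solving for `k ⟨c, x v⟩` produces the factor `p k / D`. -/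
lemma sum_inner_eq (hS : S.Nonempty) (hp : 0 < p) {G : SimpleGraph (Fin n)}
    (hG : Admissible S E G) {x : Fin n → EuclideanSpace ℝ (Fin n)} (hx : IsFeasible G x)
    {v : Fin n} (hv : v ∉ S) (hdeg : 0 < ∑ w ∈ S, edgeInd E w v) :
    ∑ w ∈ S, (inner ℝ (x w) (x v) : ℝ) = ∑ w ∈ S, inner ℝ (x w - center S x)
      (centred p E w v • ((p * S.card / ∑ w ∈ S, edgeInd E w v) • x v)) := by
  have hk : (S.card : ℝ) ≠ 0 := by exact_mod_cast hS.card_pos.ne'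
  set D := ∑ w ∈ S, edgeInd E w v with hD
  set c := center S x with hc
  have h1 : ∑ w ∈ S, (inner ℝ (x w - c) (x v) : ℝ) = 0 := by
    rw [← sum_inner, sum_sub_center hS, inner_zero_left]
  have h2 : ∑ w ∈ S, edgeInd E w v * (inner ℝ (x w) (x v) : ℝ) = 0 := by
    refine Finset.sum_eq_zero fun w hw => ?_
    unfold edgeInd
    split_ifs with h
    · rw [hx.inner_eq_zero w v (hG.adj hw hv h), mul_zero]
    · rw [zero_mul]
  have h3 : ∑ w ∈ S, edgeInd E w v * (inner ℝ (x w - c) (x v) : ℝ) = - (D * inner ℝ c (x v)) := by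
    simp only [inner_sub_left, mul_sub, Finset.sum_sub_distrib, h2, ← Finset.sum_mul]
    rw [← hD]; ring
  have h4 : ∑ w ∈ S, (inner ℝ (x w) (x v) : ℝ) = S.card * inner ℝ c (x v) := by
    rw [← sum_inner, hc, center, real_inner_smul_left, mul_inv_cancel_left₀ hk]
  have h5 : ∀ w, (inner ℝ (x w - c) (centred p E w v • ((p * S.card / D) • x v)) : ℝ) =
      (p * S.card / D) * (inner ℝ (x w - c) (x v)) -
        (S.card / D) * (edgeInd E w v * inner ℝ (x w - c) (x v)) := by
    intro w
    rw [real_inner_smul_right, real_inner_smul_right, centred]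
    field_simp
  simp only [h5, Finset.sum_sub_distrib, ← Finset.mul_sum, h1, h3, h4]
  field_simp
  ring

/-- The vectors of `S` in an optimal solution are concentrated around their mean. -/
lemma sum_norm_sub_center_sq_le (hS : S.Nonempty) (hp : 0 < p) (hE : IsPseudorandom S p E)
    {G : SimpleGraph (Fin n)} (hG : Admissible S E G)
    {x : Fin n → EuclideanSpace ℝ (Fin n)} (hx : IsOptimal G x) :
    (S.card : ℝ) ^ 2 * ∑ w ∈ S, ‖x w - center S x‖ ^ 2 ≤ 20480 * (n : ℝ) ^ 2 / p := by
  have hk : (0 : ℝ) < S.card := by exact_mod_cast hS.card_pos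
  set c := center S x with hc
  set ζ := ∑ w ∈ S, ‖x w - c‖ ^ 2 with hζ
  have hζ0 : 0 ≤ ζ := Finset.sum_nonneg fun _ _ => sq_nonneg _
  have hdeg : ∀ v ∉ S, 0 < ∑ w ∈ S, edgeInd E w v := fun v hv =>
    lt_trans (by positivity) (hE.1 v hv)
  set y : Fin n → EuclideanSpace ℝ (Fin n) :=
    fun v => (p * S.card / ∑ w ∈ S, edgeInd E w v) • x v with hy
  have hnorm : ∀ v ∉ S, ‖y v‖ ≤ 2 := by
    intro v hv
    rw [hy, norm_smul, hx.1.norm_eq_one, mul_one, Real.norm_eq_abs,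
      abs_of_nonneg (div_nonneg (by positivity) (hdeg v hv).le), div_le_iff₀ (hdeg v hv)]
    linarith [hE.1 v hv]
  set q : Fin n → EuclideanSpace ℝ (Fin n) := fun w => ∑ v ∈ Sᶜ, centred p E w v • y v with hq
  have h1 : ∑ u ∈ S, ∑ v ∈ Sᶜ, (inner ℝ (x u) (x v) : ℝ) = ∑ w ∈ S, inner ℝ (x w - c) (q w) := by
    simp only [hq, inner_sum]
    rw [Finset.sum_comm, Finset.sum_comm (s := S)]
    refine Finset.sum_congr rfl fun v hv => ?_
    rw [Finset.mem_compl] at hv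
    exact sum_inner_eq hS hp hG hx.1 hv (hdeg v hv)
  have h2 : (∑ w ∈ S, (inner ℝ (x w - c) (q w) : ℝ)) ^ 2 ≤ ζ * (5120 * (n : ℝ) ^ 2 / p) := by
    calc (∑ w ∈ S, (inner ℝ (x w - c) (q w) : ℝ)) ^ 2
        ≤ (∑ w ∈ S, ‖x w - c‖ * ‖q w‖) ^ 2 := by
          rw [← sq_abs]
          refine pow_le_pow_left₀ (abs_nonneg _) ((Finset.abs_sum_le_sum_abs _ _).trans
            (Finset.sum_le_sum fun w _ => abs_real_inner_le_norm _ _)) 2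
      _ ≤ ζ * ∑ w ∈ S, ‖q w‖ ^ 2 := Finset.sum_mul_sq_le_sq_mul_sq _ _ _
      _ ≤ _ := mul_le_mul_of_nonneg_left (hE.sum_norm_sq_le y hnorm) hζ0
  have h3 := hx.sum_one_sub_inner_le S hG.2
  rw [← card_mul_sum_norm_sub_center_sq hS hx.1, h1] at h3
  have h4 : ((S.card : ℝ) * ζ) ^ 2 ≤ 4 * (ζ * (5120 * (n : ℝ) ^ 2 / p)) := by
    have := pow_le_pow_left₀ (by positivity) h3 2
    rw [mul_pow 2] at this
    linarith
  -- The inequality `h4` is quadratic in `ζ` on the left and linear on the right; cancel one factor.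
  rcases hζ0.eq_or_lt with h | h
  · rw [← h]
    simp only [mul_zero]
    positivity
  · refine le_of_mul_le_mul_left ?_ h
    calc ζ * ((S.card : ℝ) ^ 2 * ζ) = ((S.card : ℝ) * ζ) ^ 2 := by ring
      _ ≤ _ := h4
      _ = _ := by ring

/-- On the pseudorandom event the algorithm succeeds. -/
lemma card_le_card_output_of_isPseudorandom (hS : S.Nonempty) (hp : 0 < p) (hp1 : p ≤ 1)
    (hkn : 1310720 * (n : ℝ) ^ 2 ≤ (S.card : ℝ) ^ 3 * p ^ 2) (hE : IsPseudorandom S p E)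
    {G : SimpleGraph (Fin n)} (hG : Admissible S E G)
    {x : Fin n → EuclideanSpace ℝ (Fin n)} (hx : IsOptimal G x) :
    S.card ≤ (output G x).card := by
  have hk : (0 : ℝ) < S.card := by exact_mod_cast hS.card_pos
  set c := center S x with hc
  -- The constant in `hkn` is `64 * 20480`.
  have hζ : ∑ w ∈ S, ‖x w - c‖ ^ 2 ≤ p * S.card / 64 := by
    have h1 := sum_norm_sub_center_sq_le hS hp hE hG hx
    have h2 : 20480 * (n : ℝ) ^ 2 / p ≤ (S.card : ℝ) ^ 2 * (p * S.card / 64) := by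
      rw [div_le_iff₀ hp]
      linarith
    exact le_of_mul_le_mul_left (h1.trans h2) (by positivity)
  have hnorm : ∀ v, ‖x v‖ = 1 := hx.1.norm_eq_one
  obtain ⟨u, huS, hu⟩ : ∃ u ∈ S, ‖x u - c‖ ^ 2 ≤ 1 / 64 := by
    refine Finset.exists_le_of_sum_le hS (hζ.trans ?_)
    rw [Finset.sum_const, nsmul_eq_mul]
    nlinarith
  have hu' : ‖x u - c‖ ≤ 1 / 8 := by
    refine le_of_sq_le_sq ?_ (by norm_num)
    linarith
  -- Otherwise all neighbours of `v` in `S` are at distance at least `1/2 - 1/8 = 3/8` from `c`;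
  -- more than `p k / 2` of them would force `ζ > 9/64 * (p k / 2)`.
  have hnear : ∀ v ∉ S, ∃ w ∈ S, s(w, v) ∈ E ∧ dist (x u) (x w) < 1 / 2 := by
    intro v hv
    by_contra! hcon
    have h1 : ∀ w ∈ S, edgeInd E w v ≤ 64 / 9 * ‖x w - c‖ ^ 2 := by
      intro w hw
      unfold edgeInd
      split_ifs with h
      · have h2 := hcon w hw h
        have h3 : dist (x u) (x w) ≤ ‖x u - c‖ + ‖x w - c‖ := by
          rw [← dist_eq_norm, ← dist_eq_norm]
          exact dist_triangle_right _ _ _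
        nlinarith [norm_nonneg (x w - c)]
      · positivity
    have h2 := Finset.sum_le_sum h1
    rw [← Finset.mul_sum] at h2
    have h3 := hE.1 v hv
    have : 0 < p * S.card := by positivity
    linarith
  refine card_le_card_output G x S hG.2 u (fun v hdist => ?_) fun v hv => ?_
  · by_contra hv
    obtain ⟨w, hw, hwE, hd⟩ := hnear v hv
    -- Hence `⟨x u, x v⟩ < 1/2`, so the squared distance `2 - 2 ⟨x u, x v⟩` exceeds `1`.
    have h1 : (inner ℝ (x u) (x v) : ℝ) = inner ℝ (x u - x w) (x v) := by
      rw [inner_sub_left, hx.1.inner_eq_zero w v (hG.adj hw hv hwE), sub_zero]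
    have h2 := real_inner_le_norm (x u - x w) (x v)
    rw [hnorm, mul_one, ← dist_eq_norm, ← h1] at h2
    have h3 := norm_sub_sq_real (x u) (x v)
    rw [hnorm, hnorm, ← dist_eq_norm] at h3
    nlinarith [dist_nonneg (x := x u) (y := x v)]
  · obtain ⟨w, hw, hwE, hd⟩ := hnear v hv
    exact ⟨w, by linarith, (hG.adj hw hv hwE).symm⟩

end Analysis

end SemiRandom

/-! ### Choice of constants and conclusion -/

theorem mainTheorem4 :
    -- the crude SDP of every graph has an optimal solution
    (∀ (n : ℕ) (G : SimpleGraph (Fin n)), ∃ x, SemiRandom.IsOptimal G x) ∧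
    -- once it is solved, the algorithm takes polynomially many steps on every input
    (∃ P : Polynomial ℕ, ∀ (n : ℕ) (G : SimpleGraph (Fin n))
      (x : Fin n → EuclideanSpace ℝ (Fin n)), (SemiRandom.recover G x).steps ≤ P.eval n) ∧
    -- with high probability, whatever the adversary does, it finds an independent set of size `≥ k`
    (∃ c : ℝ, 0 < c ∧ ∀ ε : ℝ, 0 < ε → ∃ N : ℕ, ∀ n : ℕ, N ≤ n →
      ∀ p : unitInterval, 0 < p → ∀ (k : ℕ) (S : Finset (Fin n)), S.card = k →
        c * ((n : ℝ) / (p : ℝ)) ^ (2 / 3 : ℝ) ≤ (k : ℝ) →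
        1 - ε ≤ (SemiRandom.boundaryLaw S p).real
          {E' | ∀ G : SimpleGraph (Fin n), SemiRandom.Admissible S E' G →
            ∀ x, SemiRandom.IsOptimal G x →
              G.IsIndepSet (SemiRandom.output G x : Set (Fin n)) ∧
              k ≤ (SemiRandom.output G x).card}) := by
  refine ⟨fun n G => SemiRandom.exists_isOptimal G,
    ⟨.X * (21 * .X ^ 2 + 14 * .X + 5) + 1, fun n G x => ?_⟩, 110, by norm_num, fun ε hε => ?_⟩
  · simpa using SemiRandom.recover_steps G x
  obtain ⟨N, hN⟩ := SemiRandom.eventually_prob_isPseudorandom hε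
  refine ⟨max N 1, fun n hn p hp k S hcard hk => ?_⟩
  have hp' : (0 : ℝ) < p := hp
  have hn0 : (0 : ℝ) < n := by exact_mod_cast (le_max_right N 1).trans hn
  have hkn : (k : ℝ) ≤ n := by
    rw [← hcard]; exact_mod_cast (Finset.card_le_univ _).trans (by simp)
  -- Here `1331000 = 110 ^ 3`, slightly more than the `1310720` that the analysis needs.
  have hcube : 1331000 * (n : ℝ) ^ 2 ≤ (k : ℝ) ^ 3 * (p : ℝ) ^ 2 := by
    have h1 := pow_le_pow_left₀ (by positivity) hk 3
    rw [mul_pow, ← Real.rpow_natCast (_ ^ (2 / 3 : ℝ)), ← Real.rpow_mul (by positivity)] at h1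
    norm_num at h1
    rw [div_pow, ← mul_div_assoc, div_le_iff₀ (by positivity)] at h1
    exact h1
  have hk0 : (0 : ℝ) < k := lt_of_lt_of_le (by positivity) hk
  have hne : S.Nonempty := by
    rw [← Finset.card_pos, hcard]; exact_mod_cast hk0
  -- From `k ≤ n`: `(p k)² n ≥ p² k³ ≥ n²`. So expected degrees into `S` are at least `√n`, enough
  -- for a union bound over the vertices.
  have hsqrt : √n ≤ p * S.card := by
    rw [hcard]
    refine Real.sqrt_le_iff.2 ⟨by positivity, ?_⟩
    refine le_of_mul_le_mul_right ?_ hn0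
    have : ((p : ℝ) * k) ^ 2 * k ≤ (p * k) ^ 2 * n := mul_le_mul_of_nonneg_left hkn (by positivity)
    nlinarith [sq_nonneg (n : ℝ)]
  have : MeasureTheory.IsProbabilityMeasure (SemiRandom.boundaryLaw S p) := by
    unfold SemiRandom.boundaryLaw; infer_instance
  refine (hN n ((le_max_left _ _).trans hn) p S hp hsqrt).trans
    (MeasureTheory.measureReal_mono fun E hE G hG x hx => ⟨SemiRandom.output_isIndepSet G x, ?_⟩)
  rw [← hcard]
  refine SemiRandom.card_le_card_output_of_isPseudorandom hne hp' p.2.2 ?_ hE hG hx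
  rw [hcard]
  nlinarith [sq_nonneg (n : ℝ)]
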